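/- Let $U_0,U_1$ be unitary $d\times d$ matrices, $\mathcal U_b(\rho)=U_b\rho U_b^\dagger$, and $N\ge 1$. For $n\in\{0,\dots,N\}$ let $\mathcal E_n$ be the sequence of $N$ channel uses whose first $n$ uses are $\mathcal U_0$ and whose last $N-n$ uses are $\mathcal U_1$; all $n$ are equally likely, and $n$ is to be identified. A general strategy prepares a state of the system and an ancilla, applies an arbitrary quantum channel to system and ancilla between any two consecutive uses (ancillas may have any finite dimensions), and after the last use performs a measurement $\{\Pi_m\}_{m=0}^N$. A nonadaptive strategy prepares a state of $N$ copies of the system and an ancilla, applies the $N$ uses in parallel, and measures. Let $P^{(N)}$ and $P^{(N)}_{\mathrm{na}}$ be the suprema of the success probability $\frac1{N+1}\sum_{n=0}^N p_{n|n}$ over general and over nonadaptive strategies, where $p_{m|n}$ is the probability of outcome $m$ when the change point is $n$. Let $\Gamma$ be the convex hull of the eigenvalues of $U_0^\dagger U_1$ in the complex plane, and let $\lambda_0,\lambda_1$ be the ends of a side of $\Gamma$ closest to the origin (if $\Gamma$ is a segment this is its only side; if $\Gamma$ is a point, $\lambda_0=\lambda_1$ is that point). Let $\gamma=\frac12|\lambda_1-\lambda_0|$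 if $0\notin\Gamma$, and $\gamma=1$ if $0\in\Gamma$. Then $$P^{(N)}=P^{(N)}_{\mathrm{na}}=\frac{N\gamma+1}{N+1},$$ both suprema are attained, and already by a nonadaptive strategy without ancilla. Moreover $P^{(N)}<1$ if and only if $0\notin\Gamma$. Assume in addition $P^{(N)}<1$ and $\gamma>0$, and let $|\lambda_0\rangle,|\lambda_1\rangle$ be normalized eigenvectors of $U_0^\dagger U_1$ for $\lambda_0,\lambda_1$. Then the nonadaptive ancilla-free strategy with the pure input $$|\psi\rangle=\frac1{\sqrt2}\sum_{b\in\{0,1\}^N}\ \prod_{k=1}^{N-1}\sqrt{\frac{\gamma^{|b_{k+1}-b_k|}}{\gamma+1}}\ |\lambda_{b_N}\rangle\cdots|\lambda_{b_1}\rangle$$ is optimal for a suitable measurement: there are an orthonormal system $\{|\pi_m\rangle\}_{m=0}^N$ and a measurement with $\Pi_m=|\pi_m\rangle\langle\pi_m|$ for $m<N$ and $\Pi_N=\hat 1-\sum_{m<N}\Pi_m$ that has success probability $(N\gamma+1)/(N+1)$ and whose outcome probabilities for all $m,n$ are $$p_{m|n}=\bigl|\langle\pi_m|U_1^{\otimes(N-n)}\otimes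 U_0^{\otimes n}|\psi\rangle\bigr|^2=\begin{cases}\sum_{k\le 0}\mathcal L(k-n;\zeta),&m=0,\\ \mathcal L(m-n;\zeta),&0<m<N,\\ \sum_{k\ge N}\mathcal L(k-n;\zeta),&m=N,\end{cases}$$ where $\zeta=\frac{1-\gamma}{1+\gamma}$ and $\mathcal L(j;\zeta)=\frac{1-\zeta}{1+\zeta}\,\zeta^{|j|}$ ($j\in\mathbb Z$) is the discrete Laplace distribution. -/

import Mathlib

open scoped Kronecker ComplexOrder

noncomputable section

namespace ChangePoint

/-! States, measurements and channels on finite-dimensional systems. A system is given by the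
finite index type of an orthonormal basis, operators on it are complex matrices. -/

/-- Density matrices. -/
def IsState {ι : Type*} [Fintype ι] (ρ : Matrix ι ι ℂ) : Prop :=
  ρ.PosSemidef ∧ ρ.trace = 1

/-- Quantum measurements (POVMs) with the outcomes `0, …, N`. -/
def IsMeasurement {ι : Type*} [Fintype ι] [DecidableEq ι] {N : ℕ}
    (Q : Fin (N + 1) → Matrix ι ι ℂ) : Prop :=
  (∀ m, (Q m).PosSemidef) ∧ ∑ m, Q m = 1

/-- The map `Φ ⊗ id` on operators of the system extended by an `r`-dimensional system. -/
def ampliation {ι κ : Type*} (Φ : Matrix ι ι ℂ →ₗ[ℂ] Matrix κ κ ℂ) (r : ℕ)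
    (X : Matrix (ι × Fin r) (ι × Fin r) ℂ) : Matrix (κ × Fin r) (κ × Fin r) ℂ :=
  Matrix.of fun p q => Φ (Matrix.of fun i j => X (i, p.2) (j, q.2)) p.1 q.1

/-- Complete positivity: all `Φ ⊗ id` preserve positive semidefiniteness. -/
def IsCompletelyPositive {ι κ : Type*} (Φ : Matrix ι ι ℂ →ₗ[ℂ] Matrix κ κ ℂ) : Prop :=
  ∀ (r : ℕ) (X : Matrix (ι × Fin r) (ι × Fin r) ℂ),
    X.PosSemidef → (ampliation Φ r X).PosSemidef

/-- Quantum channels: completely positive trace-preserving maps. -/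
def IsChannel {ι κ : Type*} [Fintype ι] [Fintype κ]
    (Φ : Matrix ι ι ℂ →ₗ[ℂ] Matrix κ κ ℂ) : Prop :=
  IsCompletelyPositive Φ ∧ ∀ X, (Φ X).trace = X.trace

/-- Evolution `X ↦ V X V†`. -/
def conjBy {ι : Type*} [Fintype ι] (V X : Matrix ι ι ℂ) : Matrix ι ι ℂ :=
  V * X * V.conjTranspose

/-- The rank-one operator `|ψ⟩⟨ψ|`. -/
def pureState {ι : Type*} (ψ : ι → ℂ) : Matrix ι ι ℂ :=
  Matrix.vecMulVec ψ (star ψ)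

/-- The unitary of the `(k+1)`-st use (`k = 0, 1, …`) when the change point is `n`: the first
`n` uses are `U₀`, the later ones are `U₁`. -/
def useUnitary {d : ℕ} (U₀ U₁ : Matrix (Fin d) (Fin d) ℂ) (n k : ℕ) :
    Matrix (Fin d) (Fin d) ℂ :=
  if n < k + 1 then U₁ else U₀

/-! General (adaptive, ancilla-assisted) strategies. -/

/-- A general strategy for `N ≥ 1` uses of a channel on a `d`-dimensional system.
`anc k` is the ancillary system held during the `(k+1)`-st use, `ρ` is the initial state,
`σ k` is the channel applied between the uses `k + 1` and `k + 2`, and `Q` is the measurement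
after the last use. Only `anc k` with `k < N` and `σ k` with `k + 1 < N` play a role. -/
structure Strategy (d N : ℕ) where
  anc : ℕ → Type
  ancFintype : ∀ k, Fintype (anc k)
  ancDecidableEq : ∀ k, DecidableEq (anc k)
  ρ : Matrix (Fin d × anc 0) (Fin d × anc 0) ℂ
  isState : IsState ρ
  σ : ∀ k, Matrix (Fin d × anc k) (Fin d × anc k) ℂ →ₗ[ℂ]
    Matrix (Fin d × anc (k + 1)) (Fin d × anc (k + 1)) ℂ
  isChannel : ∀ k, k + 1 < N → IsChannel (σ k)
  Q : Fin (N + 1) → Matrix (Fin d × anc (N - 1)) (Fin d × anc (N - 1)) ℂ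
  isMeasurement : IsMeasurement Q

attribute [instance] Strategy.ancFintype Strategy.ancDecidableEq

/-- The state right after the `(k+1)`-st use, if the `(j+1)`-st use is the unitary `V j`. -/
def Strategy.output {d N : ℕ} (S : Strategy d N) (V : ℕ → Matrix (Fin d) (Fin d) ℂ) :
    (k : ℕ) → Matrix (Fin d × S.anc k) (Fin d × S.anc k) ℂ
  | 0 => conjBy (V 0 ⊗ₖ (1 : Matrix (S.anc 0) (S.anc 0) ℂ)) S.ρ
  | k + 1 => conjBy (V (k + 1) ⊗ₖ (1 : Matrix (S.anc (k + 1)) (S.anc (k + 1)) ℂ))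
      (S.σ k (S.output V k))

/-- The probability of the outcome `m` when the change point is `n`. -/
def Strategy.prob {d N : ℕ} (S : Strategy d N) (U₀ U₁ : Matrix (Fin d) (Fin d) ℂ)
    (m n : Fin (N + 1)) : ℝ :=
  (S.Q m * S.output (useUnitary U₀ U₁ n) (N - 1)).trace.re

/-- The success probability for equally likely change points `0, …, N`. -/
def Strategy.success {d N : ℕ} (S : Strategy d N) (U₀ U₁ : Matrix (Fin d) (Fin d) ℂ) : ℝ :=
  1 / ((N : ℝ) + 1) * ∑ n, S.prob U₀ U₁ n n

/-! Nonadaptive strategies. -/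

/-- The parallel composition of the `N` uses when the change point is `n`, on the tensor product
of `N` copies of the `d`-dimensional system. -/
def parallelUnitary {d : ℕ} (N : ℕ) (U₀ U₁ : Matrix (Fin d) (Fin d) ℂ) (n : ℕ) :
    Matrix (Fin N → Fin d) (Fin N → Fin d) ℂ :=
  Matrix.of fun i j => ∏ k : Fin N, useUnitary U₀ U₁ n k (i k) (j k)

/-- An input state and a measurement with the outcomes `0, …, N`, on one and the same system. -/
structure Protocol (ι : Type*) [Fintype ι] [DecidableEq ι] (N : ℕ) where
  ρ : Matrix ι ι ℂ
  isState : IsState ρ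
  Q : Fin (N + 1) → Matrix ι ι ℂ
  isMeasurement : IsMeasurement Q

/-- The probability of the outcome `m` when the unitary applied to the input is `W n`. -/
def Protocol.prob {ι : Type*} [Fintype ι] [DecidableEq ι] {N : ℕ} (S : Protocol ι N)
    (W : ℕ → Matrix ι ι ℂ) (m n : Fin (N + 1)) : ℝ :=
  (S.Q m * conjBy (W n) S.ρ).trace.re

/-- The success probability for equally likely unitaries `W 0, …, W N`. -/
def Protocol.success {ι : Type*} [Fintype ι] [DecidableEq ι] {N : ℕ} (S : Protocol ι N)
    (W : ℕ → Matrix ι ι ℂ) : ℝ :=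
  1 / ((N : ℝ) + 1) * ∑ n, S.prob W n n

/-! The attainable success probabilities in the three classes of strategies. -/

/-- All strategies: adaptive, with ancillary systems of any finite dimensions. -/
def generalValues {d : ℕ} (N : ℕ) (U₀ U₁ : Matrix (Fin d) (Fin d) ℂ) : Set ℝ :=
  {p | ∃ S : Strategy d N, S.success U₀ U₁ = p}

/-- Nonadaptive strategies, with an ancillary system of any finite dimension. -/
def nonadaptiveValues {d : ℕ} (N : ℕ) (U₀ U₁ : Matrix (Fin d) (Fin d) ℂ) : Set ℝ :=
  {p | ∃ (A : Type) (_ : Fintype A) (_ : DecidableEq A)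
    (S : Protocol ((Fin N → Fin d) × A) N),
    S.success (fun n => parallelUnitary N U₀ U₁ n ⊗ₖ (1 : Matrix A A ℂ)) = p}

/-- Nonadaptive strategies without ancillary system. -/
def ancillaFreeValues {d : ℕ} (N : ℕ) (U₀ U₁ : Matrix (Fin d) (Fin d) ℂ) : Set ℝ :=
  {p | ∃ S : Protocol (Fin N → Fin d) N, S.success (parallelUnitary N U₀ U₁) = p}

/-- The maximum success probability over all strategies. -/
def maxSuccess {d : ℕ} (N : ℕ) (U₀ U₁ : Matrix (Fin d) (Fin d) ℂ) : ℝ :=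
  sSup (generalValues N U₀ U₁)

/-- The maximum success probability over nonadaptive strategies. -/
def maxSuccessNonadaptive {d : ℕ} (N : ℕ) (U₀ U₁ : Matrix (Fin d) (Fin d) ℂ) : ℝ :=
  sSup (nonadaptiveValues N U₀ U₁)

/-! The eigenvalue polygon and the parameter `γ`. -/

/-- The polygon whose vertices are the eigenvalues of `U₀† U₁`. -/
def eigenPolygon {d : ℕ} (U₀ U₁ : Matrix (Fin d) (Fin d) ℂ) : Set ℂ :=
  convexHull ℝ (spectrum ℂ (U₀.conjTranspose * U₁))

/-- `a` and `b` are the ends of a side of the polygon with vertex set `S` (every point of `S` is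
supposed to be an extreme point of the hull). If the polygon is a segment, then this is its only
side; if it is a point, then its only side is the degenerate one. -/
def IsSide (S : Set ℂ) (a b : ℂ) : Prop :=
  a ∈ S ∧ b ∈ S ∧ (a = b → S = {a}) ∧ IsExposed ℝ (convexHull ℝ S) (segment ℝ a b)

/-- `a` and `b` are the ends of a side that is closest to the origin. -/
def IsClosestSide (S : Set ℂ) (a b : ℂ) : Prop :=
  IsSide S a b ∧ ∀ a' b', IsSide S a' b' →
    Metric.infDist 0 (segment ℝ a b) ≤ Metric.infDist 0 (segment ℝ a' b')

open Classical in
/-- The parameter `γ` for the side with the ends `l₀`, `l₁`; it is `1` if the polygon contains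
the origin. -/
def gammaParam {d : ℕ} (U₀ U₁ : Matrix (Fin d) (Fin d) ℂ) (l₀ l₁ : ℂ) : ℝ :=
  if (0 : ℂ) ∈ eigenPolygon U₀ U₁ then 1 else ‖l₁ - l₀‖ / 2

/-! The optimal input and its outcome statistics. -/

/-- The amplitude of `|λ_{b_N}⟩ ⋯ |λ_{b_1}⟩` in the input state, that is
`2^(-1/2) ∏_{k=1}^{N-1} √(γ^|b_{k+1} - b_k| / (γ + 1))`. -/
def amplitude {N : ℕ} (γ : ℝ) (b : Fin N → Fin 2) : ℝ :=
  1 / √2 * ∏ k : Fin N, if h : (k : ℕ) + 1 < N then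
    √((if b ⟨k + 1, h⟩ = b k then 1 else γ) / (γ + 1)) else 1

/-- The input vector `∑_b amplitude b · |λ_{b_N}⟩ ⋯ |λ_{b_1}⟩`, where `v c` is `|λ_c⟩`. -/
def inputVector {d : ℕ} (N : ℕ) (γ : ℝ) (v : Fin 2 → Fin d → ℂ) : (Fin N → Fin d) → ℂ :=
  fun i => ∑ b : Fin N → Fin 2, (amplitude γ b : ℂ) * ∏ k : Fin N, v (b k) (i k)

/-- The probability mass function of the discrete Laplace distribution. -/
def discreteLaplace (n : ℤ) (ζ : ℝ) : ℝ :=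
  (1 - ζ) / (1 + ζ) * ζ ^ n.natAbs

/-- The probability of `m` when a discrete Laplace variable centred at `n` is truncated to
`{0, …, N}`: all the mass below `0` goes to `0`, all the mass above `N` goes to `N`. -/
def truncatedLaplace {N : ℕ} (ζ : ℝ) (m n : Fin (N + 1)) : ℝ :=
  if (m : ℕ) = 0 then ∑' k : Set.Iic (0 : ℤ), discreteLaplace (k - n) ζ
  else if (m : ℕ) = N then ∑' k : Set.Ici (N : ℤ), discreteLaplace (k - n) ζ
  else discreteLaplace ((m : ℤ) - n) ζ

end ChangePoint

end

/-! Upper bound. The hypotheses `n` and `n + 1` differ in a single use. If the origin is outside the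
polygon, a phase `e` moves the spectrum of `U₀† U₁`, hence its numerical range, into the half-plane
`Re z ≥ ν`, where `ν` is the distance of the polygon from the origin. The closest side is a chord of
the unit circle, so half its length `γ` satisfies `γ ^ 2 + ν ^ 2 = 1`. Overlap at least `ν` means
trace distance at most `γ` (`dominated_conjBy_conjBy`), and later channels do not increase it
(`Strategy.output_dominated`). Consecutive final states are thus `γ`-close, and moving the partial
sums of the measurement along these states costs `γ` per step, so that `∑ p_{n|n} ≤ 1 + N γ`
(`sum_trace_mul_le`).

Attainment. The squared amplitudes of the input form a stationary two-state Markov chain. The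
overlap of outputs `n` and `n + L` is the expectation of the product of `L` conjugate eigenvalues
along the chain, and equals `(1 + γ L) r ^ L` with `r = √ζ` up to phases (`gram_parallelUnitary`).
The square roots of the truncated Laplace probabilities have the same Gram matrix
(`sum_rowWeight_mul_pow`). They form an invertible matrix, so some orthonormal system yields exactly
these probabilities (`exists_orthonormal_of_gram`), whose diagonal sums to `N γ + 1`.

If the origin lies in the polygon, some unit `x` has `U₀ x ⟂ U₁ x`, and the product input identifies
the change point perfectly. If `γ = 0`, guessing is optimal. Finally, a general strategy can
simulate a nonadaptive one by feeding in its systems one at a time, so one upper bound serves all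
three classes. -/

namespace ChangePoint

open Matrix

/-! ### Trace distance of states and its contraction under channels. -/

section Dominated

variable {ι κ : Type*} [Fintype ι] [Fintype κ]

open scoped MatrixOrder in
theorem exists_eq_conjTranspose_mul_self {A : Matrix ι ι ℂ} (hA : A.PosSemidef) :
    ∃ C : Matrix ι ι ℂ, A = Cᴴ * C := by
  classical
  exact CStarAlgebra.nonneg_iff_eq_star_mul_self.1 hA.nonneg

theorem trace_mul_nonneg_of_posSemidef {A B : Matrix ι ι ℂ} (hA : A.PosSemidef)
    (hB : B.PosSemidef) : 0 ≤ (A * B).trace := by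
  obtain ⟨C, rfl⟩ := exists_eq_conjTranspose_mul_self hB
  rw [← Matrix.mul_assoc, Matrix.trace_mul_comm, ← Matrix.mul_assoc]
  exact (hA.mul_mul_conjTranspose_same C).trace_nonneg

theorem re_nonneg_of_nonneg {z : ℂ} (hz : 0 ≤ z) : 0 ≤ z.re :=
  (Complex.le_def.1 hz).1

theorem conjBy_posSemidef (V : Matrix ι ι ℂ) {X : Matrix ι ι ℂ} (hX : X.PosSemidef) :
    (conjBy V X).PosSemidef :=
  hX.mul_mul_conjTranspose_same V

theorem trace_conjBy [DecidableEq ι] {V : Matrix ι ι ℂ} (hV : Vᴴ * V = 1) (X : Matrix ι ι ℂ) :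
    (conjBy V X).trace = X.trace := by
  rw [conjBy, Matrix.trace_mul_comm, ← Matrix.mul_assoc, hV, Matrix.one_mul]

theorem conjBy_sub (V X Y : Matrix ι ι ℂ) : conjBy V (X - Y) = conjBy V X - conjBy V Y := by
  simp [conjBy, Matrix.mul_sub, Matrix.sub_mul]

/-- `ρ - ρ'` is bounded above by a positive operator of trace at most `γ`; for states this says
that their trace distance is at most `γ`. -/
def Dominated (γ : ℝ) (ρ ρ' : Matrix ι ι ℂ) : Prop :=
  ∃ P : Matrix ι ι ℂ, P.PosSemidef ∧ (P - (ρ - ρ')).PosSemidef ∧ P.trace.re ≤ γ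

theorem Dominated.conjBy [DecidableEq ι] {γ : ℝ} {ρ ρ' V : Matrix ι ι ℂ} (h : Dominated γ ρ ρ')
    (hV : Vᴴ * V = 1) : Dominated γ (conjBy V ρ) (ChangePoint.conjBy V ρ') := by
  obtain ⟨P, hP, hP', ht⟩ := h
  refine ⟨ChangePoint.conjBy V P, conjBy_posSemidef V hP, ?_, by rwa [trace_conjBy hV]⟩
  simpa only [conjBy_sub] using conjBy_posSemidef V hP'

theorem IsChannel.posSemidef {Φ : Matrix ι ι ℂ →ₗ[ℂ] Matrix κ κ ℂ} (hΦ : IsChannel Φ)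
    {X : Matrix ι ι ℂ} (hX : X.PosSemidef) : (Φ X).PosSemidef := by
  -- Ampliation by a one-dimensional system is `Φ` itself.
  have h := hΦ.1 1 (X.submatrix Prod.fst Prod.fst) (hX.submatrix _)
  exact h.submatrix (fun k => (k, (0 : Fin 1)))

theorem Dominated.channel {γ : ℝ} {ρ ρ' : Matrix ι ι ℂ} (h : Dominated γ ρ ρ')
    {Φ : Matrix ι ι ℂ →ₗ[ℂ] Matrix κ κ ℂ} (hΦ : IsChannel Φ) : Dominated γ (Φ ρ) (Φ ρ') := by
  obtain ⟨P, hP, hP', ht⟩ := h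
  refine ⟨Φ P, hΦ.posSemidef hP, ?_, by rwa [hΦ.2]⟩
  simpa only [map_sub] using hΦ.posSemidef hP'

/-- With the dominating operator `P`, `tr E(ρ - ρ') ≤ tr E P ≤ tr P ≤ γ`, using `E ≥ 0` and then `E
≤ 1`. -/
theorem Dominated.trace_mul_le [DecidableEq ι] {γ : ℝ} {ρ ρ' E : Matrix ι ι ℂ}
    (h : Dominated γ ρ ρ') (hE : E.PosSemidef) (hE' : (1 - E).PosSemidef) :
    (E * ρ).trace.re ≤ (E * ρ').trace.re + γ := by
  obtain ⟨P, hP, hP', ht⟩ := h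
  have h1 := re_nonneg_of_nonneg (trace_mul_nonneg_of_posSemidef hE hP')
  have h2 := re_nonneg_of_nonneg (trace_mul_nonneg_of_posSemidef hE' hP)
  simp only [Matrix.mul_sub, Matrix.sub_mul, Matrix.trace_sub, Complex.sub_re,
    Matrix.one_mul] at h1 h2
  linarith

/-- Two isometries `V`, `W` whose overlap has real part at least `ν` on all vectors take every
state to states of trace distance at most `√(1 - ν²)`. -/
theorem dominated_conjBy_conjBy [DecidableEq ι] {γ ν : ℝ} (hγ : 0 ≤ γ) (hν : 0 ≤ ν)
    (hγν : γ ^ 2 + ν ^ 2 = 1) {V W ρ : Matrix ι ι ℂ} (hV : Vᴴ * V = 1) (hW : Wᴴ * W = 1)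
    (hVW : (Vᴴ * W + Wᴴ * V - ((2 * ν : ℝ) : ℂ) • (1 : Matrix ι ι ℂ)).PosSemidef)
    (hρ : ρ.PosSemidef) (hρ1 : ρ.trace = 1) : Dominated γ (conjBy W ρ) (conjBy V ρ) := by
  rcases hγ.eq_or_lt with rfl | hγ
  -- For `ν = 1` the overlap hypothesis reads `-(W - V)†(W - V) ≥ 0`, which forces `W = V`.
  · have hν1 : ν = 1 := by nlinarith
    subst hν1
    set D := W - V with hD
    have h1 : Vᴴ * W + Wᴴ * V - ((2 * 1 : ℝ) : ℂ) • (1 : Matrix ι ι ℂ) = - (Dᴴ * D) := by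
      simp only [hD, Matrix.conjTranspose_sub, Matrix.mul_sub, Matrix.sub_mul, hV, hW]
      push_cast
      module
    rw [h1] at hVW
    have h2 := hVW.trace_nonneg
    have h3 := (Matrix.posSemidef_conjTranspose_mul_self D).trace_nonneg
    rw [Matrix.trace_neg] at h2
    have h4 : (Dᴴ * D).trace = 0 := le_antisymm (by simpa using h2) h3
    rw [Matrix.trace_conjTranspose_mul_self_eq_zero_iff, sub_eq_zero] at h4
    subst h4
    exact ⟨0, Matrix.PosSemidef.zero, by simpa using Matrix.PosSemidef.zero, by simp⟩
  -- The trace bound below is `(1 + ν + t² (1 - ν)) / (2 t)` for `t ≥ 1`; this `t` minimizes it,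
  -- with minimum `γ`.
  · set t : ℝ := (1 + ν) / γ with ht
    have htγ : t * γ = 1 + ν := by rw [ht]; field_simp
    have ht0 : 0 < t := by positivity
    have ht1 : 0 ≤ t ^ 2 - 1 := by
      have : γ ≤ 1 + ν := by nlinarith
      have : 1 ≤ t := by rwa [ht, le_div_iff₀ hγ, one_mul]
      nlinarith
    have ht2 : t ^ 2 * (1 - ν) = 1 + ν := by
      have : t ^ 2 * (1 - ν) * γ ^ 2 = (1 + ν) * γ ^ 2 := by
        calc t ^ 2 * (1 - ν) * γ ^ 2 = (t * γ) ^ 2 * (1 - ν) := by ring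
          _ = (1 + ν) * (1 - ν ^ 2) := by rw [htγ]; ring
          _ = _ := by rw [← hγν]; ring
      exact mul_right_cancel₀ (by positivity) this
    -- By polarization `KρK† - K'ρK'† = 4t (WρW† - VρV†)`, so `KρK† / (4t)` dominates the difference
    -- with remainder `K'ρK'† / (4t)`.
    set K : Matrix ι ι ℂ := (W + V) + (t : ℂ) • (W - V) with hK
    set K' : Matrix ι ι ℂ := (W + V) - (t : ℂ) • (W - V) with hK'
    have hc0 : (0 : ℂ) ≤ ((1 / (4 * t) : ℝ) : ℂ) := by
      rw [Complex.zero_le_real]; positivity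
    have hKK : Kᴴ * K = ((4 * t * γ : ℝ) : ℂ) • (1 : Matrix ι ι ℂ) - ((t ^ 2 - 1 : ℝ) : ℂ) •
        (Vᴴ * W + Wᴴ * V - ((2 * ν : ℝ) : ℂ) • (1 : Matrix ι ι ℂ)) := by
      simp only [hK, Matrix.conjTranspose_add, Matrix.conjTranspose_sub,
        Matrix.conjTranspose_smul, Matrix.mul_add, Matrix.add_mul, Matrix.mul_sub,
        Matrix.sub_mul, hV, hW, Matrix.smul_mul, Matrix.mul_smul, smul_add, smul_sub, smul_smul]
      have e1 : (4 * t * γ : ℝ) = 2 * (1 + t ^ 2) - (t ^ 2 - 1) * (2 * ν) := by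
        linear_combination 4 * htγ - 2 * ht2
      rw [e1]
      simp only [Complex.star_def, Complex.conj_ofReal]
      push_cast
      module
    refine ⟨((1 / (4 * t) : ℝ) : ℂ) • conjBy K ρ, (conjBy_posSemidef K hρ).smul hc0, ?_, ?_⟩
    · have : ((1 / (4 * t) : ℝ) : ℂ) • conjBy K ρ - (conjBy W ρ - conjBy V ρ) =
          ((1 / (4 * t) : ℝ) : ℂ) • conjBy K' ρ := by
        have : conjBy W ρ - conjBy V ρ =
            ((1 / (4 * t) : ℝ) : ℂ) • ((4 * t : ℝ) : ℂ) • (conjBy W ρ - conjBy V ρ) := by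
          rw [smul_smul, ← Complex.ofReal_mul, one_div_mul_cancel (by positivity),
            Complex.ofReal_one, one_smul]
        rw [this, ← smul_sub]
        congr 1
        simp only [conjBy, hK, hK', Matrix.conjTranspose_add, Matrix.conjTranspose_sub,
          Matrix.conjTranspose_smul, Matrix.mul_add, Matrix.add_mul, Matrix.mul_sub,
          Matrix.sub_mul, Matrix.smul_mul, Matrix.mul_smul, smul_add, smul_sub, smul_smul]
        simp only [Complex.star_def, Complex.conj_ofReal]
        push_cast
        module
      rw [this]
      exact (conjBy_posSemidef K' hρ).smul hc0
    · have h1 : (conjBy K ρ).trace = (Kᴴ * K * ρ).trace := by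
        rw [conjBy, Matrix.trace_mul_comm, ← Matrix.mul_assoc]
      have h2 := re_nonneg_of_nonneg (trace_mul_nonneg_of_posSemidef hVW hρ)
      rw [Matrix.trace_smul, h1, hKK, Matrix.sub_mul, Matrix.trace_sub, Matrix.smul_mul,
        Matrix.smul_mul, Matrix.trace_smul, Matrix.trace_smul, Matrix.one_mul, hρ1]
      simp only [smul_eq_mul, Complex.re_ofReal_mul, Complex.sub_re, Complex.ofReal_re, mul_one]
      rw [div_mul_eq_mul_div, div_le_iff₀ (by positivity)]
      nlinarith [mul_nonneg ht1 h2]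

end Dominated

/-- If consecutive states are close, then the total probability of correct identification
is bounded. -/
theorem sum_trace_mul_le {ι : Type*} [Fintype ι] [DecidableEq ι] {γ : ℝ} {N : ℕ}
    {Q : Fin (N + 1) → Matrix ι ι ℂ} (hQ : IsMeasurement Q) (ρ : ℕ → Matrix ι ι ℂ)
    (hρ : (ρ N).trace = 1) (hd : ∀ n < N, Dominated γ (ρ n) (ρ (n + 1))) :
    ∑ n : Fin (N + 1), (Q n * ρ n).trace.re ≤ N * γ + 1 := by
  set q : ℕ → Matrix ι ι ℂ := fun n => if h : n < N + 1 then Q ⟨n, h⟩ else 0 with hq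
  have hqQ : ∀ n : Fin (N + 1), q n = Q n := fun n => dif_pos n.2
  have hqpos : ∀ n, (q n).PosSemidef := fun n => by
    simp only [hq]
    split_ifs
    · exact hQ.1 _
    · exact Matrix.PosSemidef.zero
  have hqsum : ∑ n ∈ Finset.range (N + 1), q n = 1 := by
    rw [← hQ.2, Finset.sum_range]
    exact Finset.sum_congr rfl fun n _ => hqQ n
  -- With `E_j = Q_0 + ⋯ + Q_j`, replacing `ρ j` by `ρ (j + 1)` under `E_j` costs at most `γ`, and
  -- the new term completes `E_{j+1}`. At the end `E_N = 1`.
  have key : ∀ j ≤ N, ∑ n ∈ Finset.range (j + 1), (q n * ρ n).trace.re ≤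
      ((∑ n ∈ Finset.range (j + 1), q n) * ρ j).trace.re + j * γ := by
    intro j
    induction j with
    | zero => intro _; simp
    | succ j ih =>
      intro hj
      have h1 := ih (by omega)
      have hE : (∑ n ∈ Finset.range (j + 1), q n).PosSemidef :=
        Matrix.posSemidef_sum _ fun n _ => hqpos n
      have hE' : (1 - ∑ n ∈ Finset.range (j + 1), q n).PosSemidef := by
        rw [← hqsum, ← Finset.sum_range_add_sum_Ico q (show j + 1 ≤ N + 1 by omega),
          add_sub_cancel_left]
        exact Matrix.posSemidef_sum _ fun n _ => hqpos n
      have h2 := (hd j (by omega)).trace_mul_le hE hE'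
      rw [Finset.sum_range_succ, Finset.sum_range_succ q, Matrix.add_mul, Matrix.trace_add,
        Complex.add_re]
      push_cast
      linarith
  have h := key N le_rfl
  rw [hqsum, Matrix.one_mul, hρ, Finset.sum_range] at h
  simp only [Complex.one_re] at h
  refine le_trans (le_of_eq (Finset.sum_congr rfl fun n _ => by rw [hqQ])) (h.trans (by linarith))

/-! ### The upper bound for adaptive strategies. -/

section Strategy

variable {d N : ℕ}

theorem sub_kronecker {ι κ : Type*} (A B : Matrix ι ι ℂ) (C : Matrix κ κ ℂ) :
    (A - B) ⊗ₖ C = A ⊗ₖ C - B ⊗ₖ C := by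
  ext
  simp [sub_mul]

theorem kronecker_one_isometry {ι κ : Type*} [Fintype ι] [DecidableEq ι] [Fintype κ]
    [DecidableEq κ] {V : Matrix ι ι ℂ} (hV : Vᴴ * V = 1) :
    (V ⊗ₖ (1 : Matrix κ κ ℂ))ᴴ * (V ⊗ₖ (1 : Matrix κ κ ℂ)) = 1 := by
  rw [Matrix.conjTranspose_kronecker, ← Matrix.mul_kronecker_mul, hV, Matrix.conjTranspose_one,
    Matrix.one_mul, Matrix.one_kronecker_one]

theorem Strategy.output_isState (S : Strategy d N) {V : ℕ → Matrix (Fin d) (Fin d) ℂ}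
    (hV : ∀ k, (V k)ᴴ * V k = 1) {k : ℕ} (hk : k ≤ N - 1) : IsState (S.output V k) := by
  induction k with
  | zero =>
    refine ⟨conjBy_posSemidef _ S.isState.1, ?_⟩
    rw [Strategy.output, trace_conjBy (kronecker_one_isometry (hV 0)), S.isState.2]
  | succ k ih =>
    have hS := ih (by omega)
    have hc := S.isChannel k (by omega)
    refine ⟨conjBy_posSemidef _ (hc.posSemidef hS.1), ?_⟩
    rw [Strategy.output, trace_conjBy (kronecker_one_isometry (hV _)), hc.2, hS.2]

theorem Strategy.output_congr (S : Strategy d N) {V V' : ℕ → Matrix (Fin d) (Fin d) ℂ} {k : ℕ}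
    (h : ∀ j ≤ k, V j = V' j) : S.output V k = S.output V' k := by
  induction k with
  | zero => rw [Strategy.output, Strategy.output, h 0 le_rfl]
  | succ k ih =>
    rw [Strategy.output, Strategy.output, ih fun j hj => h j (by omega), h (k + 1) le_rfl]

/-- Replacing a single use changes the final state only a little. -/
theorem Strategy.output_dominated (S : Strategy d N) {γ ν : ℝ} (hγ : 0 ≤ γ) (hν : 0 ≤ ν)
    (hγν : γ ^ 2 + ν ^ 2 = 1) {V V' : ℕ → Matrix (Fin d) (Fin d) ℂ} {n : ℕ}
    (hne : ∀ k, k ≠ n → V k = V' k) (hV : ∀ k, (V k)ᴴ * V k = 1)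
    (hV' : (V' n)ᴴ * V' n = 1) {e : ℂ} (he : star e * e = 1)
    (hover : ((V' n)ᴴ * (star e • V n) + (star e • V n)ᴴ * V' n -
      ((2 * ν : ℝ) : ℂ) • (1 : Matrix (Fin d) (Fin d) ℂ)).PosSemidef) {k : ℕ} (hnk : n ≤ k)
    (hk : k ≤ N - 1) : Dominated γ (S.output V k) (S.output V' k) := by
  -- The differing use, applied to a common state. The phase `star e` disappears under conjugation,
  -- so it may be inserted to get the overlap bound.
  have base : ∀ (A : Type) [Fintype A] [DecidableEq A] (ρ : Matrix (Fin d × A) (Fin d × A) ℂ),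
      IsState ρ → Dominated γ (ChangePoint.conjBy (V n ⊗ₖ (1 : Matrix A A ℂ)) ρ)
        (ChangePoint.conjBy (V' n ⊗ₖ (1 : Matrix A A ℂ)) ρ) := by
    intro A _ _ ρ hρ
    have h1 : ChangePoint.conjBy (V n ⊗ₖ (1 : Matrix A A ℂ)) ρ =
        ChangePoint.conjBy ((star e • V n) ⊗ₖ (1 : Matrix A A ℂ)) ρ := by
      simp only [ChangePoint.conjBy, Matrix.smul_kronecker, Matrix.conjTranspose_smul,
        Matrix.smul_mul, Matrix.mul_smul, smul_smul, star_star, mul_comm e, he, one_smul]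
    rw [h1]
    refine dominated_conjBy_conjBy hγ hν hγν (kronecker_one_isometry hV')
      (kronecker_one_isometry ?_) ?_ hρ.1 hρ.2
    · simp only [Matrix.conjTranspose_smul, Matrix.smul_mul, Matrix.mul_smul, smul_smul,
        star_star, he, one_smul, hV]
    · have := hover.kronecker (Matrix.PosSemidef.one (n := A) (R := ℂ))
      rw [sub_kronecker, Matrix.add_kronecker, Matrix.smul_kronecker,
        Matrix.one_kronecker_one] at this
      simpa only [Matrix.conjTranspose_kronecker, ← Matrix.mul_kronecker_mul,
        Matrix.conjTranspose_one, Matrix.one_mul] using this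
  -- Up to use `n` the histories agree; afterwards both undergo the same channels and unitaries.
  induction k, hnk using Nat.le_induction with
  | base =>
    cases n with
    | zero => exact base _ _ S.isState
    | succ n =>
      rw [Strategy.output, Strategy.output,
        ← S.output_congr (V := V) (V' := V') fun j hj => hne j (by omega)]
      have hS := S.output_isState hV (k := n) (by omega)
      have hc := S.isChannel n (by omega)
      exact base _ _ ⟨hc.posSemidef hS.1, by rw [hc.2, hS.2]⟩
  | succ k hnk ih =>
    rw [Strategy.output, Strategy.output, ← hne (k + 1) (by omega)]
    exact ((ih (by omega)).channel (S.isChannel k (by omega))).conjBy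
      (kronecker_one_isometry (hV _))

/-- The upper bound on the success probability of a general strategy. -/
theorem Strategy.success_le (S : Strategy d N) {γ ν : ℝ} (hγ : 0 ≤ γ) (hν : 0 ≤ ν)
    (hγν : γ ^ 2 + ν ^ 2 = 1) {U₀ U₁ : Matrix (Fin d) (Fin d) ℂ} (hU₀ : U₀ᴴ * U₀ = 1)
    (hU₁ : U₁ᴴ * U₁ = 1) {e : ℂ} (he : star e * e = 1)
    (hover : (U₀ᴴ * (star e • U₁) + (star e • U₁)ᴴ * U₀ -
      ((2 * ν : ℝ) : ℂ) • (1 : Matrix (Fin d) (Fin d) ℂ)).PosSemidef) :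
    S.success U₀ U₁ ≤ (N * γ + 1) / (N + 1) := by
  have huse : ∀ n k, (useUnitary U₀ U₁ n k)ᴴ * useUnitary U₀ U₁ n k = 1 := fun n k => by
    unfold useUnitary
    split_ifs <;> assumption
  have h := sum_trace_mul_le S.isMeasurement (γ := γ)
    (fun n => S.output (useUnitary U₀ U₁ n) (N - 1))
    (S.output_isState (huse N) le_rfl).2 fun n hn => by
      -- Counted from `0`, the use with index `n` is `U₁` for change point `n` and `U₀` for `n + 1`.
      refine S.output_dominated hγ hν hγν (n := n) (fun k hk => ?_) (huse n) (huse (n + 1) n) he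
        ?_ (by omega) le_rfl
      · unfold useUnitary
        congr 1
        simp only [eq_iff_iff]
        omega
      · simpa [useUnitary] using hover
  have hN : (0 : ℝ) < N + 1 := by positivity
  rw [Strategy.success, one_div, inv_mul_eq_div, div_le_div_iff_of_pos_right hN]
  exact h

end Strategy

/-! ### Spectrum and numerical range of a unitary. -/

section Spectral

variable {ι : Type*} [Fintype ι] [DecidableEq ι]

open scoped Matrix.Norms.L2Operator in
theorem norm_eq_one_of_mem_spectrum {U : Matrix ι ι ℂ} (hU : U ∈ Matrix.unitaryGroup ι ℂ) {z : ℂ}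
    (hz : z ∈ spectrum ℂ U) : ‖z‖ = 1 := by
  simpa using spectrum.subset_circle_of_unitary hU hz

open scoped Matrix.Norms.L2Operator MatrixOrder in
/-- A half-plane containing the spectrum of a unitary also contains its numerical range. -/
theorem posSemidef_of_forall_mem_spectrum {U : Matrix ι ι ℂ} (hU : U ∈ Matrix.unitaryGroup ι ℂ)
    {e : ℂ} {ν : ℝ} (h : ∀ z ∈ spectrum ℂ U, ν ≤ (star e * z).re) :
    (star e • U + e • Uᴴ - ((2 * ν : ℝ) : ℂ) • (1 : Matrix ι ι ℂ)).PosSemidef := by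
  have hn : IsStarNormal U := isStarNormal_of_mem_unitary hU
  -- The operator in question is the functional calculus of `2 (Re (star e * z) - ν)`, which is
  -- nonnegative on the spectrum.
  have h1 : 0 ≤ cfc (fun z : ℂ => star e * z + e * star z - ((2 * ν : ℝ) : ℂ)) U := by
    refine cfc_nonneg fun z hz => ?_
    have : star e * z + e * star z - ((2 * ν : ℝ) : ℂ) =
        ((2 * ((star e * z).re - ν) : ℝ) : ℂ) := by
      apply Complex.ext <;> simp <;> ring
    rw [this, Complex.zero_le_real]
    linarith [h z hz]
  rw [cfc_sub _ _ U (by fun_prop) (by fun_prop), cfc_add U _ _ (by fun_prop) (by fun_prop),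
    cfc_const_mul_id _ U, cfc_const_mul _ _ U (by fun_prop), cfc_star_id U, cfc_const _ U] at h1
  rw [Matrix.nonneg_iff_posSemidef, Algebra.algebraMap_eq_smul_one] at h1
  exact h1

end Spectral

/-! ### Geometry of the eigenvalue polygon. -/

section Polygon

/-- The real inner product of two complex numbers. -/
theorem real_inner_eq (p z : ℂ) : inner ℝ p z = p.re * z.re + p.im * z.im := by
  rw [Complex.inner]
  simp [mul_comm]

/-- The variational inequality for the projection of the origin onto `K`: the line through `p`
perpendicular to `p` supports `K`. -/
theorem le_inner_of_forall_norm_le {K : Set ℂ} (hK : Convex ℝ K) {p : ℂ} (hp : p ∈ K)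
    (h : ∀ z ∈ K, ‖p‖ ≤ ‖z‖) : ∀ z ∈ K, ‖p‖ ^ 2 ≤ inner ℝ p z := by
  have h1 := (norm_eq_iInf_iff_real_inner_le_zero hK (u := 0) hp).1 (by
    have : Nonempty K := ⟨⟨p, hp⟩⟩
    refine le_antisymm (le_ciInf fun w => by simpa using h w w.2) ?_
    refine ciInf_le ⟨0, ?_⟩ (⟨p, hp⟩ : K)
    rintro _ ⟨w, rfl⟩
    exact norm_nonneg _)
  intro z hz
  have := h1 z hz
  rw [zero_sub, inner_neg_left, inner_sub_right, real_inner_self_eq_norm_sq] at this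
  linarith

/-- A point of the convex hull on a supporting line is in the hull of the generators on it. -/
theorem mem_convexHull_of_inner_eq {S : Set ℂ} {p x : ℂ} {c : ℝ}
    (hS : ∀ z ∈ S, c ≤ inner ℝ p z) (hx : x ∈ convexHull ℝ S) (hxc : inner ℝ p x = c) :
    x ∈ convexHull ℝ {z ∈ S | inner ℝ p z = c} := by
  classical
  obtain ⟨ι, _, w, z, hw, hw1, hz, rfl⟩ := mem_convexHull_iff_exists_fintype.1 hx
  -- A vanishing sum of nonnegative terms: every point with nonzero weight lies on the line.
  have h1 : ∑ i, w i * (inner ℝ p (z i) - c) = 0 := by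
    simp only [mul_sub, Finset.sum_sub_distrib, ← Finset.sum_mul, hw1, one_mul]
    rw [← hxc, inner_sum, sub_eq_zero]
    exact Finset.sum_congr rfl fun i _ => (real_inner_smul_right _ _ _).symm
  have h2 := (Finset.sum_eq_zero_iff_of_nonneg fun i _ =>
    mul_nonneg (hw i) (sub_nonneg.2 (hS _ (hz i)))).1 h1
  have h3 : ∀ i, w i ≠ 0 → inner ℝ p (z i) = c := fun i hi => by
    have := (mul_eq_zero.1 (h2 i (Finset.mem_univ i))).resolve_left hi
    linarith
  rw [← Finset.sum_filter_of_ne (p := fun i => w i ≠ 0)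
    (fun i _ hi h0 => hi (by rw [h0, zero_smul]))]
  refine (convex_convexHull ℝ _).sum_mem (fun i _ => hw i) ?_ fun i hi => subset_convexHull ℝ _ ?_
  · rw [Finset.sum_filter_of_ne (fun i _ hi => hi), hw1]
  · exact ⟨hz i, h3 i (Finset.mem_filter.1 hi).2⟩

/-- A nonempty finite set on the unit circle whose hull avoids the origin has a side containing
the point of the hull nearest to the origin. -/
theorem exists_isSide {S : Set ℂ} (hS : ∀ z ∈ S, ‖z‖ = 1) (h0 : (0 : ℂ) ∉ convexHull ℝ S) {p : ℂ}
    (hp : p ∈ convexHull ℝ S) (hmin : ∀ z ∈ convexHull ℝ S, ‖p‖ ≤ ‖z‖) :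
    ∃ a b, IsSide S a b ∧ p ∈ segment ℝ a b := by
  have hp0 : p ≠ 0 := fun h => h0 (h ▸ hp)
  have hin := le_inner_of_forall_norm_le (convex_convexHull ℝ S) hp hmin
  have hinS : ∀ z ∈ S, ‖p‖ ^ 2 ≤ inner ℝ p z := fun z hz => hin z (subset_convexHull ℝ _ hz)
  -- `T` consists of the vertices on the supporting line through `p`. Its hull is the exposed face
  -- containing `p`, and a line meets the circle in at most two points.
  set T : Set ℂ := {z ∈ S | inner ℝ p z = ‖p‖ ^ 2} with hT
  have hface : {x ∈ convexHull ℝ S | ∀ y ∈ convexHull ℝ S,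
      (-(innerSL ℝ p)) y ≤ (-(innerSL ℝ p)) x} = convexHull ℝ T := by
    apply Set.Subset.antisymm
    · rintro x ⟨hx, hxm⟩
      refine mem_convexHull_of_inner_eq hinS hx (le_antisymm ?_ (hin x hx))
      have := hxm p hp
      simp only [_root_.neg_apply, innerSL_apply_apply, neg_le_neg_iff,
        real_inner_self_eq_norm_sq] at this
      exact this
    · refine convexHull_min ?_ ?_
      · rintro x ⟨hx, hxc⟩
        refine ⟨subset_convexHull ℝ _ hx, fun y hy => ?_⟩
        simpa [hxc] using hin y hy
      · have hexp : IsExposed ℝ (convexHull ℝ S) {x ∈ convexHull ℝ S |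
            ∀ y ∈ convexHull ℝ S, (-(innerSL ℝ p)) y ≤ (-(innerSL ℝ p)) x} := fun _ => ⟨_, rfl⟩
        exact hexp.convex (convex_convexHull ℝ S)
  have hexp : IsExposed ℝ (convexHull ℝ S) (convexHull ℝ T) := fun _ => ⟨_, hface.symm⟩
  have hpT : p ∈ convexHull ℝ T :=
    mem_convexHull_of_inner_eq hinS hp (real_inner_self_eq_norm_sq p)
  obtain ⟨a, ha⟩ : T.Nonempty := convexHull_nonempty_iff.1 ⟨p, hpT⟩
  by_cases hb : ∃ b ∈ T, b ≠ a
  · obtain ⟨b, hb, hba⟩ := hb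
    have hTab : T = {a, b} := by
      apply Set.Subset.antisymm
      · intro z hz
        -- on the line, a point of the circle is determined by the sign of the other coordinate
        have hq : ∀ w ∈ T, (p.re * w.im - p.im * w.re) ^ 2 = ‖p‖ ^ 2 - ‖p‖ ^ 4 := by
          rintro w ⟨hw, hwc⟩
          have h1 : w.re ^ 2 + w.im ^ 2 = 1 := by
            have := Complex.sq_norm w
            rw [hS w hw, Complex.normSq_apply] at this
            linarith
          have h2 : p.re ^ 2 + p.im ^ 2 = ‖p‖ ^ 2 := by
            rw [Complex.sq_norm p, Complex.normSq_apply]; ring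
          rw [real_inner_eq] at hwc
          have : ‖p‖ ^ 4 = (p.re * w.re + p.im * w.im) ^ 2 := by rw [hwc]; ring
          rw [this, ← h2]
          linear_combination (p.re ^ 2 + p.im ^ 2) * h1
        have hinj : ∀ w ∈ T, ∀ w' ∈ T, p.re * w.im - p.im * w.re = p.re * w'.im - p.im * w'.re →
            w = w' := by
          rintro w ⟨_, hw⟩ w' ⟨_, hw'⟩ h
          rw [← hw', real_inner_eq, real_inner_eq] at hw
          have hpos : p.re ^ 2 + p.im ^ 2 ≠ 0 := by
            have : p.re ^ 2 + p.im ^ 2 = ‖p‖ ^ 2 := by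
              rw [Complex.sq_norm p, Complex.normSq_apply]; ring
            rw [this]
            positivity
          apply Complex.ext
          · apply mul_left_cancel₀ hpos
            linear_combination p.re * hw - p.im * h
          · apply mul_left_cancel₀ hpos
            linear_combination p.im * hw + p.re * h
        have h1 := sq_eq_sq_iff_eq_or_eq_neg.1 ((hq z hz).trans (hq a ha).symm)
        have h2 := sq_eq_sq_iff_eq_or_eq_neg.1 ((hq b hb).trans (hq a ha).symm)
        rcases h1 with h1 | h1
        · exact Or.inl (hinj z hz a ha h1)
        · rcases h2 with h2 | h2
          · exact absurd (hinj b hb a ha h2) hba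
          · exact Or.inr (hinj z hz b hb (h1.trans h2.symm))
      · rintro z (rfl | rfl) <;> assumption
    rw [hTab, convexHull_pair] at hexp hpT
    exact ⟨a, b, ⟨ha.1, hb.1, fun h => absurd h.symm hba, hexp⟩, hpT⟩
  · push Not at hb
    have hTa : T = {a} := Set.Subset.antisymm hb (by simpa using ha)
    rw [hTa, convexHull_singleton] at hexp hpT
    rw [← segment_same ℝ a] at hexp
    obtain rfl : p = a := hpT
    refine ⟨p, p, ⟨ha.1, ha.1, fun _ => ?_, hexp⟩, by simp⟩
    -- Here the nearest point `p` itself has norm `1`. Cauchy–Schwarz puts every vertex on the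
    -- supporting line, so the polygon is one point, as a degenerate side requires.
    refine Set.Subset.antisymm (fun z hz => hb z ⟨hz, ?_⟩) (by simpa using ha.1)
    refine le_antisymm ?_ (hinS z hz)
    have := real_inner_le_norm p z
    rw [hS z hz, hS p ha.1] at this
    rw [hS p ha.1]
    linarith

theorem sq_add_sq_eq_one_of_norm {a : ℂ} (ha : ‖a‖ = 1) : a.re ^ 2 + a.im ^ 2 = 1 := by
  have := Complex.sq_norm a
  rw [ha, Complex.normSq_apply] at this
  linarith

theorem sq_norm_eq (a : ℂ) : ‖a‖ ^ 2 = a.re ^ 2 + a.im ^ 2 := by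
  rw [Complex.sq_norm, Complex.normSq_apply]
  ring

/-- Since `‖a‖ = ‖b‖`, the midpoint is perpendicular to `a - b`. At parameter `t` the squared norm
exceeds that of the midpoint by `(1/2 - t)² ‖a - b‖²`. -/
theorem norm_midpoint_le_of_mem_segment {a b z : ℂ} (ha : ‖a‖ = 1) (hb : ‖b‖ = 1)
    (hz : z ∈ segment ℝ a b) : ‖(a + b) / 2‖ ≤ ‖z‖ := by
  obtain ⟨s, t, hs, ht, hst, rfl⟩ := hz
  have h1 := sq_add_sq_eq_one_of_norm ha
  have h2 := sq_add_sq_eq_one_of_norm hb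
  rw [← pow_le_pow_iff_left₀ (norm_nonneg _) (norm_nonneg _) two_ne_zero, sq_norm_eq, sq_norm_eq]
  simp only [Complex.div_ofNat_re, Complex.div_ofNat_im, Complex.add_re, Complex.add_im,
    Complex.real_smul, Complex.re_ofReal_mul, Complex.im_ofReal_mul]
  obtain rfl : s = 1 - t := by linarith
  nlinarith [mul_nonneg (sq_nonneg (1 - 2 * t))
    (add_nonneg (sq_nonneg (a.re - b.re)) (sq_nonneg (a.im - b.im)))]

/-- The closest side of a polygon with vertices on the unit circle that avoids the origin:
after a rotation by `star e` it is vertical at the real part `ν`, the whole polygon lies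
to its right, and half its length is `√(1 - ν²)`. -/
theorem IsClosestSide.exists_rotation {S : Set ℂ} (hfin : S.Finite) (hS : ∀ z ∈ S, ‖z‖ = 1)
    (h0 : (0 : ℂ) ∉ convexHull ℝ S) {l₀ l₁ : ℂ} (h : IsClosestSide S l₀ l₁) :
    ∃ (e : ℂ) (ν : ℝ), star e * e = 1 ∧ 0 < ν ∧ (‖l₁ - l₀‖ / 2) ^ 2 + ν ^ 2 = 1 ∧
      (∀ z ∈ S, ν ≤ (star e * z).re) ∧ ∃ s : ℝ, s ^ 2 = 1 ∧
        star e * l₀ = ν + (‖l₁ - l₀‖ / 2 * s : ℝ) * Complex.I ∧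
        star e * l₁ = ν - (‖l₁ - l₀‖ / 2 * s : ℝ) * Complex.I := by
  obtain ⟨⟨hl₀, hl₁, -, -⟩, hclose⟩ := h
  have hn₀ := hS _ hl₀
  have hn₁ := hS _ hl₁
  set m : ℂ := (l₀ + l₁) / 2 with hm
  have hmseg : m ∈ segment ℝ l₀ l₁ := by
    refine ⟨1 / 2, 1 / 2, by norm_num, by norm_num, by norm_num, ?_⟩
    rw [hm]
    simp only [Complex.real_smul]
    push_cast
    ring
  have hmhull : m ∈ convexHull ℝ S :=
    segment_subset_convexHull hl₀ hl₁ hmseg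
  -- The nearest point of the polygon lies on some side, and no side is closer than the given one;
  -- hence the midpoint `m` is also nearest.
  have hmin : ∀ z ∈ convexHull ℝ S, ‖m‖ ≤ ‖z‖ := by
    obtain ⟨p, hp, hpmin⟩ := (hfin.isCompact_convexHull ℝ).exists_isMinOn ⟨m, hmhull⟩
      continuous_norm.continuousOn
    obtain ⟨a, b, hab, hpab⟩ := exists_isSide hS h0 hp hpmin
    have h1 := hclose a b hab
    have h2 : Metric.infDist 0 (segment ℝ a b) ≤ ‖p‖ := by
      simpa using Metric.infDist_le_dist_of_mem (x := (0 : ℂ)) hpab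
    have h3 : ‖m‖ ≤ Metric.infDist 0 (segment ℝ l₀ l₁) := by
      rw [Metric.le_infDist ⟨m, hmseg⟩]
      intro z hz
      rw [dist_zero_left]
      exact norm_midpoint_le_of_mem_segment hn₀ hn₁ hz
    exact fun z hz => (h3.trans (h1.trans h2)).trans (hpmin hz)
  have hm0 : m ≠ 0 := fun h => h0 (h ▸ hmhull)
  have hin := le_inner_of_forall_norm_le (convex_convexHull ℝ S) hmhull hmin
  have hmpos : 0 < ‖m‖ := norm_pos_iff.2 hm0
  have hmC : (‖m‖ : ℂ) ≠ 0 := by exact_mod_cast hmpos.ne'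
  have hmm : star m * m = (‖m‖ : ℂ) * ‖m‖ := by
    rw [Complex.star_def, mul_comm, Complex.mul_conj, Complex.normSq_eq_norm_sq]
    push_cast
    ring
  have h1 := sq_add_sq_eq_one_of_norm hn₀
  have h2 := sq_add_sq_eq_one_of_norm hn₁
  have hgm : (‖l₁ - l₀‖ / 2) ^ 2 + ‖m‖ ^ 2 = 1 := by
    rw [div_pow, sq_norm_eq, sq_norm_eq, hm]
    simp only [Complex.div_ofNat_re, Complex.div_ofNat_im, Complex.add_re, Complex.add_im,
      Complex.sub_re, Complex.sub_im]
    linear_combination (h1 + h2) / 2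
  have hse : star (m / ‖m‖) = star m / ‖m‖ := by simp
  refine ⟨m / ‖m‖, ‖m‖, ?_, hmpos, hgm, ?_, ?_⟩
  · rw [hse, div_mul_div_comm, hmm, div_self (mul_ne_zero hmC hmC)]
  · intro z hz
    have h3 := hin z (subset_convexHull ℝ _ hz)
    rw [hse, div_mul_eq_mul_div, Complex.div_ofReal_re, le_div_iff₀ hmpos, ← sq]
    rw [real_inner_eq] at h3
    simpa using h3
  · -- the rotated half-side `w` is purely imaginary
    set w : ℂ := star (m / ‖m‖) * ((l₀ - l₁) / 2) with hw
    have hwn : ‖w‖ = ‖l₁ - l₀‖ / 2 := by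
      rw [hw, norm_mul, norm_star, norm_div, Complex.norm_real, norm_norm,
        div_self hmpos.ne', one_mul, norm_div, norm_sub_rev]
      simp
    have hwre : w.re = 0 := by
      rw [hw, hse, div_mul_eq_mul_div, Complex.div_ofReal_re, hm]
      have : (star ((l₀ + l₁) / 2) * ((l₀ - l₁) / 2)).re = 0 := by
        simp only [Complex.star_def, Complex.mul_re, Complex.conj_re, Complex.conj_im,
          Complex.div_ofNat_re, Complex.div_ofNat_im, Complex.add_re, Complex.add_im,
          Complex.sub_re, Complex.sub_im]
        linear_combination (h1 - h2) / 4
      rw [this, zero_div]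
    have hm' : star (m / ‖m‖) * m = ‖m‖ := by
      rw [hse, div_mul_eq_mul_div, hmm, mul_div_assoc, div_self hmC, mul_one]
    have hwI : w = (w.im : ℂ) * Complex.I := by
      apply Complex.ext <;> simp [hwre]
    have hwabs : |w.im| = ‖l₁ - l₀‖ / 2 := by
      rw [← hwn]
      conv_rhs => rw [hwI]
      simp
    -- The sign `s` is needed because the order of the two ends of the side is arbitrary.
    obtain ⟨s, hs, hws⟩ : ∃ s : ℝ, s ^ 2 = 1 ∧ w.im = ‖l₁ - l₀‖ / 2 * s := by
      rw [← hwabs]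
      rcases abs_choice w.im with h | h
      · exact ⟨1, by norm_num, by rw [h, mul_one]⟩
      · exact ⟨-1, by norm_num, by rw [h]; ring⟩
    refine ⟨s, hs, ?_, ?_⟩
    · have : star (m / ‖m‖) * l₀ = star (m / ‖m‖) * m + w := by
        rw [hw, ← mul_add]
        congr 1
        rw [hm]
        ring
      rw [this, hm', ← hws, ← hwI]
    · have : star (m / ‖m‖) * l₁ = star (m / ‖m‖) * m - w := by
        rw [hw, ← mul_sub]
        congr 1
        rw [hm]
        ring
      rw [this, hm', ← hws, ← hwI]

end Polygon

/-! ### Tensor products of operators and vectors. -/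

section PiTensor

variable {d N : ℕ}

/-- The tensor product of `N` operators. -/
def piTensor (F : Fin N → Matrix (Fin d) (Fin d) ℂ) :
    Matrix (Fin N → Fin d) (Fin N → Fin d) ℂ :=
  Matrix.of fun i j => ∏ k, F k (i k) (j k)

/-- The tensor product of `N` vectors. -/
def piVec (x : Fin N → Fin d → ℂ) : (Fin N → Fin d) → ℂ := fun i => ∏ k, x k (i k)

theorem parallelUnitary_eq (U₀ U₁ : Matrix (Fin d) (Fin d) ℂ) (n : ℕ) :
    parallelUnitary N U₀ U₁ n = piTensor fun k => useUnitary U₀ U₁ n k := rfl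

theorem piTensor_mul (F G : Fin N → Matrix (Fin d) (Fin d) ℂ) :
    piTensor F * piTensor G = piTensor fun k => F k * G k := by
  ext i j
  simp only [piTensor, Matrix.mul_apply, Matrix.of_apply, ← Finset.prod_mul_distrib]
  rw [Finset.prod_univ_sum, Fintype.piFinset_univ]

theorem piTensor_one : piTensor (fun _ : Fin N => (1 : Matrix (Fin d) (Fin d) ℂ)) = 1 := by
  ext i j
  simp only [piTensor, Matrix.of_apply, Matrix.one_apply, Finset.prod_ite_zero,
    Finset.prod_const_one, funext_iff, Finset.mem_univ, true_implies]

theorem piTensor_conjTranspose (F : Fin N → Matrix (Fin d) (Fin d) ℂ) :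
    (piTensor F)ᴴ = piTensor fun k => (F k)ᴴ := by
  ext i j
  simp [piTensor, Matrix.conjTranspose_apply]

theorem piTensor_mulVec (F : Fin N → Matrix (Fin d) (Fin d) ℂ) (x : Fin N → Fin d → ℂ) :
    piTensor F *ᵥ piVec x = piVec fun k => F k *ᵥ x k := by
  ext i
  simp only [piTensor, piVec, Matrix.mulVec, dotProduct, Matrix.of_apply,
    ← Finset.prod_mul_distrib]
  rw [Finset.prod_univ_sum, Fintype.piFinset_univ]

theorem star_piVec_dotProduct (x y : Fin N → Fin d → ℂ) :
    star (piVec x) ⬝ᵥ piVec y = ∏ k, star (x k) ⬝ᵥ y k := by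
  simp only [piVec, dotProduct, Pi.star_apply, star_prod, ← Finset.prod_mul_distrib]
  rw [Finset.prod_univ_sum, Fintype.piFinset_univ]

end PiTensor

/-! ### Simulation of nonadaptive strategies by adaptive ones. -/

section Simulation

variable {ι κ : Type*} [Fintype ι] [Fintype κ]

theorem conjBy_submatrix (A X : Matrix ι ι ℂ) (e : κ ≃ ι) :
    conjBy (A.submatrix e e) (X.submatrix e e) = (conjBy A X).submatrix e e := by
  simp [conjBy, Matrix.conjTranspose_submatrix, Matrix.submatrix_mul_equiv]

theorem conjBy_mul (A B X : Matrix ι ι ℂ) : conjBy A (conjBy B X) = conjBy (A * B) X := by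
  simp [conjBy, Matrix.mul_assoc, Matrix.conjTranspose_mul]

theorem trace_submatrix_equiv (X : Matrix ι ι ℂ) (e : κ ≃ ι) :
    (X.submatrix e e).trace = X.trace := by
  simp only [Matrix.trace, Matrix.diag_apply, Matrix.submatrix_apply]
  exact e.sum_comp fun i => X i i

theorem IsState.submatrix {ρ : Matrix ι ι ℂ} (hρ : IsState ρ) (e : κ ≃ ι) :
    IsState (ρ.submatrix e e) :=
  ⟨hρ.1.submatrix e, by rw [trace_submatrix_equiv, hρ.2]⟩

theorem IsMeasurement.submatrix [DecidableEq ι] [DecidableEq κ] {N : ℕ}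
    {Q : Fin (N + 1) → Matrix ι ι ℂ} (hQ : IsMeasurement Q) (e : κ ≃ ι) :
    IsMeasurement fun m => (Q m).submatrix e e := by
  refine ⟨fun m => (hQ.1 m).submatrix e, ?_⟩
  have : ∑ m, (Q m).submatrix e e = (∑ m, Q m).submatrix e e := by
    ext i j
    simp [Matrix.sum_apply]
  rw [this, hQ.2, Matrix.submatrix_one_equiv]

theorem isChannel_reindex (e : ι ≃ κ) :
    IsChannel (Matrix.reindexLinearEquiv ℂ ℂ e e).toLinearMap := by
  refine ⟨fun r X hX => ?_, fun X => ?_⟩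
  · exact hX.submatrix fun p : κ × Fin r => (e.symm p.1, p.2)
  · exact trace_submatrix_equiv X e.symm

/-- A nonadaptive protocol on an equivalent system. -/
def Protocol.submatrix [DecidableEq ι] [DecidableEq κ] {N : ℕ} (S : Protocol ι N) (e : κ ≃ ι) :
    Protocol κ N where
  ρ := S.ρ.submatrix e e
  isState := S.isState.submatrix e
  Q := fun m => (S.Q m).submatrix e e
  isMeasurement := S.isMeasurement.submatrix e

theorem Protocol.submatrix_success [DecidableEq ι] [DecidableEq κ] {N : ℕ} (S : Protocol ι N)
    (e : κ ≃ ι) (W : ℕ → Matrix ι ι ℂ) :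
    (S.submatrix e).success (fun n => (W n).submatrix e e) = S.success W := by
  simp only [Protocol.success, Protocol.prob, Protocol.submatrix, conjBy_submatrix,
    Matrix.submatrix_mul_equiv, trace_submatrix_equiv]

theorem ancillaFreeValues_subset {d N : ℕ} (U₀ U₁ : Matrix (Fin d) (Fin d) ℂ) :
    ancillaFreeValues N U₀ U₁ ⊆ nonadaptiveValues N U₀ U₁ := by
  rintro _ ⟨S, rfl⟩
  refine ⟨Unit, inferInstance, inferInstance, S.submatrix (Equiv.prodPUnit _), ?_⟩
  rw [← S.submatrix_success (Equiv.prodPUnit _)]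
  congr 1
  funext n
  ext i j
  simp [Matrix.kroneckerMap_apply]

variable {d M : ℕ}

/-- Singling out the `k`-th of the `M + 1` systems. -/
def pickOut (d M : ℕ) (A : Type) (k : Fin (M + 1)) :
    Fin d × ((Fin M → Fin d) × A) ≃ (Fin (M + 1) → Fin d) × A :=
  (Equiv.prodAssoc _ _ _).symm.trans
    (Equiv.prodCongr (Fin.insertNthEquiv (fun _ => Fin d) k) (Equiv.refl A))

/-- One use acting on the singled-out system, with the other `M` systems counted as ancilla, is a
tensor product with a single nontrivial factor. -/
theorem kronecker_one_eq_submatrix (A : Type) [DecidableEq A] (V : Matrix (Fin d) (Fin d) ℂ)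
    (k : Fin (M + 1)) :
    V ⊗ₖ (1 : Matrix ((Fin M → Fin d) × A) ((Fin M → Fin d) × A) ℂ) =
      ((piTensor fun j => if j = k then V else 1) ⊗ₖ (1 : Matrix A A ℂ)).submatrix
        (pickOut d M A k) (pickOut d M A k) := by
  ext ⟨x, f, a⟩ ⟨y, g, b⟩
  have h := congrFun (congrFun (piTensor_one (d := d) (N := M)) f) g
  simp only [piTensor, Matrix.of_apply] at h
  have h1 : (1 : Matrix ((Fin M → Fin d) × A) ((Fin M → Fin d) × A) ℂ) (f, a) (g, b) =
      (1 : Matrix (Fin M → Fin d) (Fin M → Fin d) ℂ) f g * (1 : Matrix A A ℂ) a b := by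
    rw [← Matrix.one_kronecker_one, Matrix.kroneckerMap_apply]
  change V x y * (1 : Matrix ((Fin M → Fin d) × A) ((Fin M → Fin d) × A) ℂ) (f, a) (g, b) =
    (∏ j, (if j = k then V else 1) (k.insertNth (α := fun _ => Fin d) x f j)
      (k.insertNth (α := fun _ => Fin d) y g j)) * (1 : Matrix A A ℂ) a b
  have h2 : ∀ (x : Fin d) (f : Fin M → Fin d) (j : Fin M),
      k.insertNth (α := fun _ => Fin d) x f (k.succAbove j) = f j := fun x f j =>
    Fin.insertNth_apply_succAbove (α := fun _ => Fin d) k x f j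
  rw [Fin.prod_univ_succAbove _ k, h1, ← h]
  simp only [h2, Fin.succAbove_ne, if_false, if_true, Fin.insertNth_apply_same, mul_assoc]

/-- The adaptive strategy that uses the systems of a nonadaptive protocol one after another. -/
def Protocol.toStrategy {A : Type} [Fintype A] [DecidableEq A]
    (S : Protocol ((Fin (M + 1) → Fin d) × A) (M + 1)) : Strategy d (M + 1) where
  anc := fun _ => (Fin M → Fin d) × A
  ancFintype := fun _ => inferInstance
  ancDecidableEq := fun _ => inferInstance
  ρ := S.ρ.submatrix (pickOut d M A 0) (pickOut d M A 0)
  isState := S.isState.submatrix _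
  -- The intermediate channel only relabels which system enters the next use. `Fin.ofNat` makes the
  -- index total; only `k ≤ M` matters.
  σ := fun k => (Matrix.reindexLinearEquiv ℂ ℂ
    ((pickOut d M A (Fin.ofNat (M + 1) k)).trans (pickOut d M A (Fin.ofNat (M + 1) (k + 1))).symm)
    ((pickOut d M A (Fin.ofNat (M + 1) k)).trans
      (pickOut d M A (Fin.ofNat (M + 1) (k + 1))).symm)).toLinearMap
  isChannel := fun _ _ => isChannel_reindex _
  Q := fun m => (S.Q m).submatrix (pickOut d M A (Fin.last M)) (pickOut d M A (Fin.last M))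
  isMeasurement := S.isMeasurement.submatrix _

/-- The invariant of the simulation: systems up to `k` have passed their use, the later ones are
still untouched. -/
theorem Protocol.toStrategy_output {A : Type} [Fintype A] [DecidableEq A]
    (S : Protocol ((Fin (M + 1) → Fin d) × A) (M + 1)) (V : ℕ → Matrix (Fin d) (Fin d) ℂ) {k : ℕ}
    (hk : k ≤ M) : S.toStrategy.output V k =
      (conjBy ((piTensor fun j => if (j : ℕ) ≤ k then V j else 1) ⊗ₖ (1 : Matrix A A ℂ))
        S.ρ).submatrix (pickOut d M A (Fin.ofNat (M + 1) k))
          (pickOut d M A (Fin.ofNat (M + 1) k)) := by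
  induction k with
  | zero =>
    have h0 : Fin.ofNat (M + 1) 0 = 0 := rfl
    rw [Strategy.output, h0]
    refine (congrArg₂ conjBy (kronecker_one_eq_submatrix A (V 0) 0) rfl).trans ?_
    refine (conjBy_submatrix _ S.ρ _).trans ?_
    congr! 5 with j
    by_cases h : j = 0 <;> simp [h]
  | succ k ih =>
    rw [Strategy.output, ih (by omega)]
    set e := pickOut d M A (Fin.ofNat (M + 1) k)
    set e' := pickOut d M A (Fin.ofNat (M + 1) (k + 1)) with he'
    have hσ : ∀ X : Matrix _ _ ℂ, S.toStrategy.σ k (X.submatrix e e) = X.submatrix e' e' := by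
      intro X
      change (X.submatrix e e).submatrix (e.trans e'.symm).symm (e.trans e'.symm).symm = _
      rw [Matrix.submatrix_submatrix]
      congr 1 <;> (funext i; simp)
    refine (congrArg (conjBy _) (hσ _)).trans ?_
    refine (congrArg₂ conjBy
      (kronecker_one_eq_submatrix A (V (k + 1)) (Fin.ofNat (M + 1) (k + 1))) rfl).trans ?_
    refine (conjBy_submatrix _ _ _).trans ?_
    rw [conjBy_mul, ← Matrix.mul_kronecker_mul, piTensor_mul, Matrix.one_mul]
    congr! 5 with j
    have hj : j = Fin.ofNat (M + 1) (k + 1) ↔ (j : ℕ) = k + 1 := by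
      rw [Fin.ext_iff, Fin.val_ofNat, Nat.mod_eq_of_lt (by omega)]
    simp only [hj]
    by_cases h : (j : ℕ) = k + 1
    · simp [h]
    · have : (j : ℕ) ≤ k + 1 ↔ (j : ℕ) ≤ k := by omega
      simp [h, this]

theorem nonadaptiveValues_subset {d N : ℕ} (hN : 1 ≤ N) (U₀ U₁ : Matrix (Fin d) (Fin d) ℂ) :
    nonadaptiveValues N U₀ U₁ ⊆ generalValues N U₀ U₁ := by
  obtain ⟨M, rfl⟩ : ∃ M, N = M + 1 := ⟨N - 1, by omega⟩
  rintro _ ⟨A, _, _, S, rfl⟩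
  refine ⟨S.toStrategy, ?_⟩
  simp only [Strategy.success, Protocol.success]
  congr 1
  refine Finset.sum_congr rfl fun n _ => ?_
  rw [Strategy.prob, Protocol.prob]
  have h : S.toStrategy.output (useUnitary U₀ U₁ n) (M + 1 - 1) = _ :=
    S.toStrategy_output (useUnitary U₀ U₁ n) (le_refl M)
  have hlast : Fin.ofNat (M + 1) (M + 1 - 1) = Fin.last M := by
    ext
    simp
  have hp : (piTensor fun j : Fin (M + 1) => if (j : ℕ) ≤ M + 1 - 1 then
      useUnitary U₀ U₁ n j else 1) = parallelUnitary (M + 1) U₀ U₁ n := by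
    rw [parallelUnitary_eq]
    congr! 2 with j
    rw [if_pos (by omega)]
  rw [hlast, hp] at h
  refine (congrArg (fun X => (Matrix.trace (S.toStrategy.Q n * X)).re) h).trans ?_
  refine congrArg Complex.re ?_
  refine Eq.trans (congrArg Matrix.trace (Matrix.submatrix_mul_equiv _ _ _ _ _)) ?_
  exact trace_submatrix_equiv _ _

end Simulation

/-! ### Projective measurements from Gram matrices. -/

section Measurement

variable {ι : Type*} [Fintype ι]

theorem pureState_posSemidef (ψ : ι → ℂ) : (pureState ψ).PosSemidef :=
  Matrix.posSemidef_vecMulVec_self_star ψ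

theorem isState_pureState {ψ : ι → ℂ} (hψ : star ψ ⬝ᵥ ψ = 1) : IsState (pureState ψ) := by
  refine ⟨pureState_posSemidef ψ, ?_⟩
  rw [pureState, Matrix.trace_vecMulVec, dotProduct_comm, hψ]

theorem conjBy_pureState (V : Matrix ι ι ℂ) (ψ : ι → ℂ) :
    conjBy V (pureState ψ) = pureState (V *ᵥ ψ) := by
  rw [conjBy, pureState, pureState, Matrix.mul_vecMulVec, Matrix.vecMulVec_mul, Matrix.star_mulVec]

theorem pureState_mul_pureState (φ ψ : ι → ℂ) :
    pureState φ * pureState ψ = (star φ ⬝ᵥ ψ) • Matrix.vecMulVec φ (star ψ) := by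
  rw [pureState, pureState, Matrix.vecMulVec_mul_vecMulVec, Matrix.vecMulVec_smul]

theorem trace_pureState_mul_pureState (φ ψ : ι → ℂ) :
    (pureState φ * pureState ψ).trace = ((‖star φ ⬝ᵥ ψ‖ ^ 2 : ℝ) : ℂ) := by
  have h : φ ⬝ᵥ star ψ = star (star φ ⬝ᵥ ψ) := by
    rw [Matrix.star_dotProduct, star_star, dotProduct_comm]
  rw [pureState_mul_pureState, Matrix.trace_smul, Matrix.trace_vecMulVec, h, smul_eq_mul,
    Complex.star_def, Complex.mul_conj, Complex.normSq_eq_norm_sq]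

/-- Vectors with a prescribed Gram matrix `AᴴA` are expressed by `A` in some orthonormal system. -/
theorem exists_orthonormal_of_gram {κ : Type*} [Fintype κ] [DecidableEq κ] {A : Matrix κ κ ℂ}
    (hA : IsUnit A.det) {φ : κ → ι → ℂ}
    (hφ : ∀ n n', star (φ n) ⬝ᵥ φ n' = (Aᴴ * A) n n') :
    ∃ p : κ → ι → ℂ, (∀ m m', star (p m) ⬝ᵥ p m' = if m = m' then 1 else 0) ∧
      ∀ m n, star (p m) ⬝ᵥ φ n = A m n := by
  set F : Matrix ι κ ℂ := Matrix.of fun i n => φ n i with hF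
  have hFF : Fᴴ * F = Aᴴ * A := by
    ext n n'
    rw [← hφ]
    rfl
  -- The columns of `F A⁻¹` are orthonormal because `F†F = A†A`.
  set P : Matrix ι κ ℂ := F * A⁻¹ with hP
  have hPF : Pᴴ * F = A := by
    rw [hP, Matrix.conjTranspose_mul, Matrix.mul_assoc, hFF, ← Matrix.mul_assoc,
      ← Matrix.conjTranspose_mul, Matrix.mul_nonsing_inv _ hA, Matrix.conjTranspose_one,
      Matrix.one_mul]
  have hPP : Pᴴ * P = 1 := by
    conv_lhs => rw [hP]
    rw [← hP, ← Matrix.mul_assoc, hPF, Matrix.mul_nonsing_inv _ hA]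
  refine ⟨fun m i => P i m, fun m m' => ?_, fun m n => ?_⟩
  · rw [← Matrix.one_apply, ← hPP]
    rfl
  · rw [← hPF]
    rfl

variable [DecidableEq ι] {N : ℕ}

/-- The measurement defined by an orthonormal system, with the last projection enlarged. -/
theorem isMeasurement_of_orthonormal {p : Fin (N + 1) → ι → ℂ}
    (hp : ∀ m m', star (p m) ⬝ᵥ p m' = if m = m' then 1 else 0) :
    IsMeasurement fun m => if m = Fin.last N then
      1 - ∑ k ∈ Finset.univ.erase (Fin.last N), pureState (p k) else pureState (p m) := by
  set B : Matrix ι ι ℂ := ∑ k ∈ Finset.univ.erase (Fin.last N), pureState (p k) with hB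
  have hBh : Bᴴ = B := (Matrix.posSemidef_sum _ fun k _ => pureState_posSemidef (p k)).1
  have hBB : B * B = B := by
    rw [hB, Finset.sum_mul]
    refine Finset.sum_congr rfl fun k hk => ?_
    rw [Finset.mul_sum, Finset.sum_eq_single_of_mem k hk]
    · rw [pureState_mul_pureState, hp, if_pos rfl, one_smul, pureState]
    · intro k' _ hk'
      rw [pureState_mul_pureState, hp, if_neg hk'.symm, zero_smul]
  refine ⟨fun m => ?_, ?_⟩
  · dsimp only
    split_ifs
    · have : 1 - B = (1 - B)ᴴ * (1 - B) := by
        rw [Matrix.conjTranspose_sub, Matrix.conjTranspose_one, hBh]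
        simp [Matrix.mul_sub, Matrix.sub_mul, hBB]
      rw [this]
      exact Matrix.posSemidef_conjTranspose_mul_self _
    · exact pureState_posSemidef _
  · rw [← Finset.add_sum_erase _ _ (Finset.mem_univ (Fin.last N)), if_pos rfl]
    rw [Finset.sum_congr rfl fun m hm => if_neg (Finset.ne_of_mem_erase hm), ← hB,
      sub_add_cancel]

/-- If the evolved inputs lie in the span of an orthonormal system, then that system defines
a protocol with the Born probabilities. -/
theorem exists_protocol {p : Fin (N + 1) → ι → ℂ}
    (hp : ∀ m m', star (p m) ⬝ᵥ p m' = if m = m' then 1 else 0) {ψ : ι → ℂ}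
    (hψ : star ψ ⬝ᵥ ψ = 1) {W : ℕ → Matrix ι ι ℂ} (hW : ∀ n, (W n)ᴴ * W n = 1)
    (hsum : ∀ n : Fin (N + 1), ∑ m, ‖star (p m) ⬝ᵥ W n *ᵥ ψ‖ ^ 2 = 1) :
    ∃ S : Protocol ι N, S.ρ = pureState ψ ∧ (∀ m, m ≠ Fin.last N → S.Q m = pureState (p m)) ∧
      ∀ m n, S.prob W m n = ‖star (p m) ⬝ᵥ W n *ᵥ ψ‖ ^ 2 := by
  have hmain : ∀ k (n : Fin (N + 1)), (pureState (p k) * conjBy (W n) (pureState ψ)).trace.re =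
      ‖star (p k) ⬝ᵥ W n *ᵥ ψ‖ ^ 2 := fun k n => by
    rw [conjBy_pureState, trace_pureState_mul_pureState, Complex.ofReal_re]
  refine ⟨⟨pureState ψ, isState_pureState hψ, _, isMeasurement_of_orthonormal hp⟩, rfl,
    fun m hm => if_neg hm, fun m n => ?_⟩
  rw [Protocol.prob]
  dsimp only
  split_ifs with hm
  -- The enlarged last projection sees no extra weight: by `hsum` the output already has total
  -- weight one on the orthonormal system.
  · rw [Matrix.sub_mul, Matrix.one_mul, Matrix.trace_sub, trace_conjBy (hW n),
      (isState_pureState hψ).2, Finset.sum_mul, Matrix.trace_sum, Complex.sub_re, Complex.re_sum]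
    simp only [hmain, Complex.one_re]
    rw [← hsum n, ← Finset.add_sum_erase _ _ (Finset.mem_univ (Fin.last N)), hm]
    simp
  · exact hmain m n

end Measurement

/-! ### The truncated discrete Laplace distribution. -/

section Laplace

variable {N : ℕ} {γ : ℝ}

/-- The weight of row `m` in the factorization of the truncated Laplace distribution. -/
noncomputable def rowWeight (N : ℕ) (γ : ℝ) (m : ℕ) : ℝ := if m = 0 ∨ m = N then (1 + γ) / 2 else γ

theorem rowWeight_pos (hγ : 0 < γ) (m : ℕ) : 0 < rowWeight N γ m := by
  unfold rowWeight
  split_ifs <;> positivity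

theorem zeta_pos (hγ : 0 < γ) (hγ1 : γ < 1) : 0 < (1 - γ) / (1 + γ) :=
  div_pos (by linarith) (by linarith)

theorem zeta_lt_one (hγ : 0 < γ) : (1 - γ) / (1 + γ) < 1 := by
  rw [div_lt_one (by linarith)]
  linarith

/-- The prefactor `(1 - ζ) / (1 + ζ)` is `γ`, and a geometric tail collected at an end contributes
the factor `γ / (1 - ζ) = (1 + γ) / 2`. -/
theorem truncatedLaplace_eq (hγ : 0 < γ) (hγ1 : γ < 1) (m n : Fin (N + 1)) :
    truncatedLaplace ((1 - γ) / (1 + γ)) m n =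
      rowWeight N γ m * ((1 - γ) / (1 + γ)) ^ ((m : ℤ) - n).natAbs := by
  set ζ := (1 - γ) / (1 + γ) with hζ
  have hζ0 : 0 < ζ := zeta_pos hγ hγ1
  have hζ1 : ζ < 1 := zeta_lt_one hγ
  have hγζ : (1 - ζ) / (1 + ζ) = γ := by
    rw [hζ]
    field_simp
    ring
  have hw : γ * (1 - ζ)⁻¹ = (1 + γ) / 2 := by
    have : 1 - ζ = 2 * γ / (1 + γ) := by
      rw [hζ]
      field_simp
      ring
    rw [this]
    field_simp
  have hgeo : ∀ a : ℕ, ∑' j : ℕ, γ * ζ ^ (j + a) = (1 + γ) / 2 * ζ ^ a := by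
    intro a
    simp only [pow_add]
    rw [tsum_mul_left, tsum_mul_right, tsum_geometric_of_lt_one hζ0.le hζ1, ← hw]
    ring
  unfold truncatedLaplace rowWeight discreteLaplace
  rw [hγζ]
  by_cases h0 : (m : ℕ) = 0
  · let e : ℕ ≃ Set.Iic (0 : ℤ) :=
      { toFun := fun j => ⟨-(j : ℤ), by simp⟩
        invFun := fun k => (k : ℤ).natAbs
        left_inv := fun j => by simp
        right_inv := fun k => by
          have := k.2
          rw [Set.mem_Iic] at this
          ext
          simp only
          omega }
    rw [if_pos h0, if_pos (Or.inl h0), ← e.tsum_eq]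
    have : ∀ j : ℕ, (((e j : ℤ)) - (n : ℕ)).natAbs = j + n := fun j => by
      change (-(j : ℤ) - (n : ℕ)).natAbs = j + n
      omega
    simp only [this]
    rw [hgeo, h0]
    congr 2
    omega
  · rw [if_neg h0]
    by_cases hm : (m : ℕ) = N
    · let e : ℕ ≃ Set.Ici (N : ℤ) :=
        { toFun := fun j => ⟨(N : ℤ) + j, by simp⟩
          invFun := fun k => ((k : ℤ) - N).natAbs
          left_inv := fun j => by simp
          right_inv := fun k => by
            have := k.2
            rw [Set.mem_Ici] at this
            ext
            simp only
            omega }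
      rw [if_pos hm, if_pos (Or.inr hm), ← e.tsum_eq]
      have : ∀ j : ℕ, (((e j : ℤ)) - (n : ℕ)).natAbs = j + (N - n) := fun j => by
        change ((N : ℤ) + j - (n : ℕ)).natAbs = j + (N - n)
        omega
      simp only [this]
      rw [hgeo, hm]
      congr 2
      omega
    · rw [if_neg hm, if_neg (by tauto)]

/-- The two-point correlation of the amplitudes of the truncated Laplace distribution. -/
theorem sum_rowWeight_mul_pow {r : ℝ} (hγ : 0 < γ) (hr : r ^ 2 = (1 - γ) / (1 + γ))
    (hN : 1 ≤ N) {n L : ℕ} (hnL : n + L ≤ N) :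
    ∑ m ∈ Finset.range (N + 1), rowWeight N γ m * (r ^ ((m : ℤ) - n).natAbs *
      r ^ ((m : ℤ) - (n + L : ℕ)).natAbs) = (1 + γ * L) * r ^ L := by
  have hr' : (1 + γ) * r ^ 2 = 1 - γ := by
    rw [hr]
    field_simp
  set h : ℕ → ℝ := fun m => r ^ (((m : ℤ) - n).natAbs + ((m : ℤ) - (n + L : ℕ)).natAbs) with hh
  -- Partial sums including the excess `(1 - γ) / 2` of the end weight at `0` over `γ`. This excess
  -- makes them a single power of `r` up to `n`; they then grow linearly across the block, and
  -- beyond it the deficit decays geometrically until the excess at `N` cancels it.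
  set P : ℕ → ℝ := fun M => ∑ m ∈ Finset.range M, γ * h m + (1 - γ) / 2 * h 0 with hP
  have hPs : ∀ M, P (M + 1) = P M + γ * h M := fun M => by
    simp only [hP, Finset.sum_range_succ]
    ring
  have s1 : ∀ M ≤ n, P M = (1 - γ) / 2 * r ^ ((n - M) + (n - M) + L) := by
    intro M
    induction M with
    | zero =>
      intro _
      simp only [hP, hh, Finset.range_zero, Finset.sum_empty, zero_add]
      congr 2
      omega
    | succ M ih =>
      intro hM
      have e1 : h M = r ^ ((n - (M + 1)) + (n - (M + 1)) + L) * r ^ 2 := by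
        simp only [hh, ← pow_add]
        congr 1
        omega
      have e2 : r ^ ((n - M) + (n - M) + L) =
          r ^ ((n - (M + 1)) + (n - (M + 1)) + L) * r ^ 2 := by
        rw [← pow_add]
        congr 1
        omega
      rw [hPs, ih (by omega), e1, e2]
      linear_combination (1 / 2 * r ^ ((n - (M + 1)) + (n - (M + 1)) + L)) * hr'
  have s2 : ∀ j ≤ L + 1, P (n + j) = (1 - γ) / 2 * r ^ L + γ * j * r ^ L := by
    intro j
    induction j with
    | zero =>
      intro _
      rw [add_zero, s1 n le_rfl]
      simp
    | succ j ih =>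
      intro hj
      have e1 : h (n + j) = r ^ L := by
        simp only [hh]
        congr 1
        omega
      rw [← add_assoc, hPs, ih (by omega), e1]
      push_cast
      ring
  have s3 : ∀ j, P (n + L + 1 + j) =
      (1 + γ * L) * r ^ L - (1 + γ) / 2 * (r ^ 2 * r ^ (L + 2 * j)) := by
    intro j
    induction j with
    | zero =>
      rw [add_zero, add_assoc, s2 _ le_rfl]
      push_cast
      linear_combination (1 / 2 * r ^ L) * hr'
    | succ j ih =>
      have e1 : h (n + L + 1 + j) = r ^ (L + 2 * j) * r ^ 2 := by
        simp only [hh, ← pow_add]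
        congr 1
        omega
      have e2 : r ^ (L + 2 * (j + 1)) = r ^ (L + 2 * j) * r ^ 2 := by
        rw [← pow_add]
        congr 1
      rw [← add_assoc, hPs, ih, e1, e2]
      linear_combination (1 / 2 * r ^ 2 * r ^ (L + 2 * j)) * hr'
  obtain ⟨j, rfl⟩ := Nat.exists_eq_add_of_le hnL
  have hw : ∀ m, rowWeight (n + L + j) γ m = γ + (1 - γ) / 2 * (if m = 0 then 1 else 0) +
      (1 - γ) / 2 * (if m = n + L + j then 1 else 0) := by
    intro m
    unfold rowWeight
    by_cases h0 : m = 0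
    · have : m ≠ n + L + j := by omega
      simp only [h0, true_or, if_true]
      rw [if_neg (by omega)]
      ring
    · by_cases h1 : m = n + L + j
      · simp only [h1, or_true, if_true]
        rw [if_neg (by omega)]
        ring
      · simp [h0, h1]
  have e0 : h (n + L + j) = r ^ (L + 2 * j) := by
    simp only [hh]
    congr 1
    omega
  calc _ = ∑ m ∈ Finset.range (n + L + j + 1), (γ * h m +
        (1 - γ) / 2 * (if m = 0 then h m else 0) +
        (1 - γ) / 2 * (if m = n + L + j then h m else 0)) := by
        refine Finset.sum_congr rfl fun m _ => ?_
        rw [hw, ← pow_add]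
        split_ifs <;> ring
    _ = P (n + L + 1 + j) + (1 - γ) / 2 * h (n + L + j) := by
        rw [Finset.sum_add_distrib, Finset.sum_add_distrib, ← Finset.mul_sum _ _ ((1 - γ) / 2),
          ← Finset.mul_sum _ _ ((1 - γ) / 2), Finset.sum_ite_eq', Finset.sum_ite_eq',
          if_pos (by simp), if_pos (by simp)]
        simp only [hP]
        rw [show n + L + 1 + j = n + L + j + 1 by ring]
    _ = _ := by
        rw [s3, e0]
        linear_combination (-1 / 2 * r ^ (L + 2 * j)) * hr'

/-- The Kac–Murdock–Szegő matrix `r ^ |m - n|` is invertible. -/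
theorem isUnit_det_pow_natAbs {r : ℂ} (hr : r ^ 2 ≠ 1) :
    IsUnit (Matrix.of fun m n : Fin (N + 1) => r ^ ((m : ℤ) - n).natAbs).det := by
  rw [isUnit_iff_ne_zero]
  intro hdet
  obtain ⟨x, hx0, hx⟩ := Matrix.exists_mulVec_eq_zero_iff.2 hdet
  have hf : ∀ m : Fin (N + 1), ∑ n : Fin (N + 1), r ^ ((m : ℤ) - n).natAbs * x n = 0 :=
    fun m => congrFun hx m
  apply hx0
  -- Row `k` minus `r` times row `k + 1` vanishes in all columns beyond `k` and has `1 - r²` in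
  -- column `k`, so the kernel vector vanishes entry by entry.
  have key : ∀ k (hk : k < N + 1), x ⟨k, hk⟩ = 0 := by
    intro k
    induction k using Nat.strong_induction_on with
    | _ k ih =>
      intro hk
      by_cases hkN : k = N
      · have h1 := hf ⟨k, hk⟩
        rw [Finset.sum_eq_single_of_mem ⟨k, hk⟩ (Finset.mem_univ _)] at h1
        · simpa using h1
        · intro n _ hn
          have : (n : ℕ) ≠ k := fun h => hn (Fin.ext h)
          rw [ih n (by omega) n.2, mul_zero]
      · have h1 := hf ⟨k, hk⟩
        have h2 := hf ⟨k + 1, by omega⟩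
        have h3 : ∑ n : Fin (N + 1), (r ^ ((k : ℤ) - n).natAbs -
            r * r ^ (((k + 1 : ℕ) : ℤ) - n).natAbs) * x n = 0 := by
          simp only [sub_mul, Finset.sum_sub_distrib, mul_assoc, ← Finset.mul_sum]
          rw [h1, h2, mul_zero, sub_zero]
        rw [Finset.sum_eq_single_of_mem ⟨k, hk⟩ (Finset.mem_univ _)] at h3
        · refine (mul_eq_zero.1 h3).resolve_left ?_
          have e : (((k + 1 : ℕ) : ℤ) - k).natAbs = 1 := by omega
          simp only [sub_self, Int.natAbs_zero, pow_zero, e, pow_one]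
          rw [← sq]
          exact sub_ne_zero.2 hr.symm
        · intro n _ hn
          have hnk : (n : ℕ) ≠ k := fun h => hn (Fin.ext h)
          rcases lt_or_gt_of_ne hnk with h | h
          · rw [ih n h n.2, mul_zero]
          · have : r * r ^ (((k + 1 : ℕ) : ℤ) - n).natAbs = r ^ ((k : ℤ) - n).natAbs := by
              rw [← pow_succ']
              congr 1
              omega
            rw [this, sub_self, zero_mul]
  exact funext fun n => key n n.2

end Laplace

/-! ### Expectations along the Markov chain. -/

section Chain

/-- The transition probabilities of the Markov chain behind the optimal input. -/
noncomputable def transition (γ : ℝ) (c c' : Fin 2) : ℝ := (if c' = c then 1 else γ) / (γ + 1)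

theorem transition_nonneg {γ : ℝ} (hγ : 0 < γ) (c c' : Fin 2) : 0 ≤ transition γ c c' := by
  unfold transition
  split_ifs <;> positivity

theorem amplitude_sq {γ : ℝ} (hγ : 0 < γ) {M : ℕ} (b : Fin (M + 1) → Fin 2) :
    amplitude γ b ^ 2 = 1 / 2 * ∏ k : Fin M, transition γ (b k.castSucc) (b k.succ) := by
  rw [amplitude, mul_pow, Fin.prod_univ_castSucc]
  simp only [Fin.val_last, lt_irrefl, dif_neg, not_false_eq_true, mul_one]
  rw [div_pow, one_pow, Real.sq_sqrt (by norm_num), ← Finset.prod_pow]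
  congr 1
  refine Finset.prod_congr rfl fun k _ => ?_
  rw [dif_pos (by simp)]
  exact Real.sq_sqrt (transition_nonneg hγ _ _)

/-- Backward recursion for expectations of products along the chain. -/
noncomputable def chainValue (γ : ℝ) : ℕ → (ℕ → Fin 2 → ℂ) → Fin 2 → ℂ
  | 0, f, c => f 0 c
  | M + 1, f, c => f 0 c * ∑ c', (transition γ c c' : ℂ) * chainValue γ M (fun k => f (k + 1)) c'

/-- The initial weight `g` is arbitrary so that in the induction the transition row of the preceding
state can take its place. -/
theorem sum_chain (γ : ℝ) (M : ℕ) (f : ℕ → Fin 2 → ℂ) (g : Fin 2 → ℂ) :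
    ∑ b : Fin (M + 1) → Fin 2, g (b 0) *
      ((∏ k : Fin M, (transition γ (b k.castSucc) (b k.succ) : ℂ)) * ∏ k : Fin (M + 1), f k (b k)) =
      ∑ c, g c * chainValue γ M f c := by
  induction M generalizing f g with
  | zero =>
    rw [← (Equiv.funUnique (Fin 1) (Fin 2)).symm.sum_comp]
    simp [chainValue]
  | succ M ih =>
    rw [← (Fin.consEquiv fun _ => Fin 2).sum_comp, Fintype.sum_prod_type]
    refine Finset.sum_congr rfl fun c _ => ?_
    have h := ih (fun k => f (k + 1)) fun c' => (transition γ c c' : ℂ)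
    rw [chainValue, ← h, Finset.mul_sum, Finset.mul_sum]
    refine Finset.sum_congr rfl fun b _ => ?_
    simp only [Fin.consEquiv_apply]
    rw [Fin.prod_univ_succ (n := M), Fin.prod_univ_succ (n := M + 1)]
    simp only [Fin.castSucc_zero, Fin.cons_zero, Fin.cons_succ, ← Fin.succ_castSucc,
      Fin.val_zero, Fin.val_succ]
    ring

theorem sum_transition {γ : ℝ} (hγ : 0 < γ) (c : Fin 2) : ∑ c', (transition γ c c' : ℂ) = 1 := by
  have : (γ : ℂ) + 1 ≠ 0 := by exact_mod_cast (by positivity : γ + 1 ≠ 0)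
  fin_cases c <;> simp [transition, Fin.sum_univ_two] <;> field_simp
  ring

/-- Double stochasticity: the uniform distribution is stationary, so overlaps do not depend on where
a block starts. -/
theorem sum_transition' {γ : ℝ} (hγ : 0 < γ) (c' : Fin 2) : ∑ c, (transition γ c c' : ℂ) = 1 := by
  have : (γ : ℂ) + 1 ≠ 0 := by exact_mod_cast (by positivity : γ + 1 ≠ 0)
  fin_cases c' <;> simp [transition, Fin.sum_univ_two] <;> field_simp
  ring

theorem chainValue_one {γ : ℝ} (hγ : 0 < γ) (M : ℕ) (c : Fin 2) :
    chainValue γ M (fun _ _ => 1) c = 1 := by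
  induction M generalizing c with
  | zero => rfl
  | succ M ih => simp [chainValue, ih, sum_transition hγ]

/-- The phase factors of the uses `n, …, n + L - 1`. -/
def blockFactor (μ : Fin 2 → ℂ) (n L k : ℕ) (c : Fin 2) : ℂ :=
  if n ≤ k ∧ k < n + L then μ c else 1

/-- The value of the chain on a block of `L` uses. -/
noncomputable def blockValue (γ r : ℝ) (s : Fin 2 → ℝ) (L : ℕ) (c : Fin 2) : ℂ :=
  (((1 + γ * L) * r ^ L : ℝ) : ℂ) - ((s c * (γ * L * r ^ L / r) : ℝ) : ℂ) * Complex.I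

/-- The transition matrix fixes constants and multiplies the odd function `s` by `r²`. Averaging and
multiplying by `μ` therefore preserves the form constant plus multiple of `s`, and the coefficients
follow by induction on `L`. The quotient `r ^ L / r` stands for `r ^ (L - 1)`; at `L = 0` its factor
`L` removes it. -/
theorem chainValue_block {γ ν r : ℝ} (hγ : 0 < γ) (hr : 0 < r) (hr2 : (1 + γ) * r ^ 2 = 1 - γ)
    (hν : ν = (1 + γ) * r) {s : Fin 2 → ℝ} (hs : s 0 ^ 2 = 1) (hs1 : s 1 = -s 0) {μ : Fin 2 → ℂ}
    (hμ : ∀ c, μ c = (ν : ℂ) - ((γ * s c : ℝ) : ℂ) * Complex.I) (L M : ℕ) (hL : L ≤ M + 1)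
    (c : Fin 2) : chainValue γ M (blockFactor μ 0 L) c = blockValue γ r s L c := by
  have hγ1 : γ + 1 ≠ 0 := by positivity
  have hsc : ∀ c, s c ^ 2 = 1 := fun c => by
    fin_cases c
    · exact hs
    · simp [hs1, hs]
  -- the averaging step followed by multiplication with the phases
  have hstep : ∀ L c, μ c * ∑ c', (transition γ c c' : ℂ) * blockValue γ r s L c' =
      blockValue γ r s (L + 1) c := by
    intro L c
    have h1 : ∑ c', (transition γ c c' : ℂ) * blockValue γ r s L c' =
        (((1 + γ * L) * r ^ L : ℝ) : ℂ) -
          ((s c * (r ^ 2 * (γ * L * r ^ L / r)) : ℝ) : ℂ) * Complex.I := by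
      have h2 : ∑ c', transition γ c c' * s c' = s c * r ^ 2 := by
        have : r ^ 2 = (1 - γ) / (γ + 1) := by
          rw [eq_div_iff hγ1]
          linarith
        rw [this]
        fin_cases c <;> simp [transition, Fin.sum_univ_two, hs1] <;> field_simp <;> ring
      have h3 : ∑ c', (transition γ c c' : ℂ) * (s c' : ℂ) = ((s c * r ^ 2 : ℝ) : ℂ) := by
        rw [← h2]
        push_cast
        rfl
      simp only [blockValue, mul_sub, Finset.sum_sub_distrib]
      rw [← Finset.sum_mul, sum_transition hγ, one_mul]
      congr 1
      have : ∀ x, (transition γ c x : ℂ) * (((s x * (γ * L * r ^ L / r) : ℝ) : ℂ) * Complex.I) =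
          (transition γ c x : ℂ) * (s x : ℂ) * (((γ * L * r ^ L / r : ℝ) : ℂ) * Complex.I) := by
        intro x
        push_cast
        ring
      simp only [this]
      rw [← Finset.sum_mul, h3]
      push_cast
      ring
    rw [h1, hμ, blockValue]
    apply Complex.ext
    · simp only [Complex.mul_re, Complex.sub_re, Complex.sub_im, Complex.mul_im,
        Complex.ofReal_re, Complex.ofReal_im, Complex.I_re, Complex.I_im]
      have e : γ * s c * (s c * (r ^ 2 * (γ * L * r ^ L / r))) = γ * (γ * L * r ^ L * r) := by
        have : r ^ 2 * (γ * L * r ^ L / r) = γ * L * r ^ L * r := by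
          field_simp
        rw [this]
        linear_combination (γ * (γ * L * r ^ L * r)) * hsc c
      push_cast
      rw [pow_succ, hν]
      linear_combination -e
    · simp only [Complex.mul_re, Complex.sub_re, Complex.sub_im, Complex.mul_im,
        Complex.ofReal_re, Complex.ofReal_im, Complex.I_re, Complex.I_im]
      have e1 : r ^ 2 * (γ * L * r ^ L / r) = γ * L * r ^ L * r := by
        field_simp
      have e2 : γ * ((L + 1 : ℕ) : ℝ) * r ^ (L + 1) / r = γ * (L + 1) * r ^ L := by
        rw [pow_succ]
        push_cast
        field_simp
      rw [e1, e2, hν]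
      linear_combination (-s c * γ * L * r ^ L) * hr2
  have h0 : ∀ L c, blockFactor μ 0 (L + 1) 0 c = μ c := fun L c => by
    simp [blockFactor]
  have hshift : ∀ L, (fun k => blockFactor μ 0 (L + 1) (k + 1)) = blockFactor μ 0 L := fun L => by
    funext k c
    simp [blockFactor]
  have hzero : blockFactor μ 0 0 = fun _ _ => 1 := by
    funext k c
    simp [blockFactor]
  have hval0 : ∀ c, blockValue γ r s 0 c = 1 := fun c => by simp [blockValue]
  induction L generalizing M c with
  | zero => rw [hzero, chainValue_one hγ, hval0]
  | succ L ih =>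
    cases M with
    | zero =>
      obtain rfl : L = 0 := by omega
      rw [← hstep]
      simp only [hval0, mul_one, sum_transition hγ]
      exact h0 0 c
    | succ M =>
      rw [chainValue, h0, hshift, ← hstep]
      simp only [ih M (by omega)]

/-- Stationarity removes the `n` sites before the block, and the odd part cancels in the uniform
average. -/
theorem sum_chainValue_block {γ ν r : ℝ} (hγ : 0 < γ) (hr : 0 < r)
    (hr2 : (1 + γ) * r ^ 2 = 1 - γ) (hν : ν = (1 + γ) * r) {s : Fin 2 → ℝ} (hs : s 0 ^ 2 = 1)
    (hs1 : s 1 = -s 0) {μ : Fin 2 → ℂ}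
    (hμ : ∀ c, μ c = (ν : ℂ) - ((γ * s c : ℝ) : ℂ) * Complex.I) (n L M : ℕ)
    (hL : n + L ≤ M + 1) :
    ∑ c, (1 / 2 : ℂ) * chainValue γ M (blockFactor μ n L) c = (((1 + γ * L) * r ^ L : ℝ) : ℂ) := by
  induction n generalizing M with
  | zero =>
    simp only [chainValue_block hγ hr hr2 hν hs hs1 hμ L M (by omega), blockValue,
      Fin.sum_univ_two, hs1]
    push_cast
    ring
  | succ n ih =>
    have hfac : ∀ c, blockFactor μ (n + 1) L 0 c = 1 := fun c => by simp [blockFactor]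
    have hshift : (fun k => blockFactor μ (n + 1) L (k + 1)) = blockFactor μ n L := by
      funext k c
      simp only [blockFactor]
      congr 1
      simp only [eq_iff_iff]
      omega
    cases M with
    | zero =>
      obtain ⟨rfl, rfl⟩ : n = 0 ∧ L = 0 := by omega
      simp [chainValue, hfac]
    | succ M =>
      simp only [chainValue, hfac, hshift, one_mul]
      rw [← ih M (by omega), ← Finset.mul_sum, ← Finset.mul_sum, Finset.sum_comm]
      simp only [← Finset.sum_mul, sum_transition' hγ, one_mul]

end Chain

/-! ### Eigenvectors and expectation values of a unitary. -/

section Eigenvectors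

variable {ι : Type*} [Fintype ι]

theorem star_mulVec_dotProduct (A B : Matrix ι ι ℂ) (x y : ι → ℂ) :
    star (A *ᵥ x) ⬝ᵥ (B *ᵥ y) = star ((Bᴴ * A) *ᵥ x) ⬝ᵥ y := by
  rw [Matrix.star_mulVec, Matrix.star_mulVec, Matrix.conjTranspose_mul,
    Matrix.conjTranspose_conjTranspose, ← Matrix.dotProduct_mulVec, ← Matrix.dotProduct_mulVec,
    Matrix.mulVec_mulVec]

variable [DecidableEq ι]

theorem star_mulVec_dotProduct_self {A : Matrix ι ι ℂ} (hA : Aᴴ * A = 1) (x y : ι → ℂ) :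
    star (A *ᵥ x) ⬝ᵥ (A *ᵥ y) = star x ⬝ᵥ y := by
  rw [star_mulVec_dotProduct, hA, Matrix.one_mulVec]

/-- Eigenvectors of a unitary for distinct eigenvalues are orthogonal. -/
theorem dotProduct_eq_zero_of_eigenvalue_ne {U : Matrix ι ι ℂ} (hU : Uᴴ * U = 1) {x y : ι → ℂ}
    {a b : ℂ} (hx : U *ᵥ x = a • x) (hy : U *ᵥ y = b • y) (ha : ‖a‖ = 1) (hab : a ≠ b) :
    star x ⬝ᵥ y = 0 := by
  have h := star_mulVec_dotProduct_self hU x y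
  rw [hx, hy, star_smul, smul_dotProduct, dotProduct_smul, smul_smul, smul_eq_mul] at h
  by_contra hne
  have h1 : star a * b = 1 := mul_right_cancel₀ hne (h.trans (one_mul _).symm)
  apply hab
  have h2 : a * star a = 1 := by
    rw [Complex.star_def, Complex.mul_conj, Complex.normSq_eq_norm_sq, ha]
    simp
  calc a = a * (star a * b) := by rw [h1, mul_one]
    _ = b := by rw [← mul_assoc, h2, one_mul]

theorem exists_unit_eigenvector {U : Matrix ι ι ℂ} {a : ℂ} (ha : a ∈ spectrum ℂ U) :
    ∃ x : ι → ℂ, star x ⬝ᵥ x = 1 ∧ U *ᵥ x = a • x := by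
  rw [← Matrix.spectrum_toLin' U, ← Module.End.hasEigenvalue_iff_mem_spectrum] at ha
  obtain ⟨x, hx, hx0⟩ := ha.exists_hasEigenvector
  rw [Module.End.mem_eigenspace_iff, Matrix.toLin'_apply] at hx
  have hpos : 0 < ∑ i, ‖x i‖ ^ 2 := by
    obtain ⟨i, hi⟩ := Function.ne_iff.1 hx0
    refine Finset.sum_pos' (fun i _ => sq_nonneg _) ⟨i, Finset.mem_univ i, ?_⟩
    have : 0 < ‖x i‖ := norm_pos_iff.2 hi
    positivity
  have hxx : star x ⬝ᵥ x = ((∑ i, ‖x i‖ ^ 2 : ℝ) : ℂ) := by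
    rw [dotProduct, Complex.ofReal_sum]
    refine Finset.sum_congr rfl fun i _ => ?_
    rw [Pi.star_apply, Complex.star_def, mul_comm, Complex.mul_conj, Complex.normSq_eq_norm_sq]
  set t := ∑ i, ‖x i‖ ^ 2
  refine ⟨((√t)⁻¹ : ℝ) • x, ?_, ?_⟩
  · rw [star_smul, smul_dotProduct, dotProduct_smul, hxx, smul_smul, star_trivial, ← mul_inv,
      Real.mul_self_sqrt hpos.le, Complex.real_smul, ← Complex.ofReal_mul,
      inv_mul_cancel₀ hpos.ne', Complex.ofReal_one]
  · rw [Matrix.mulVec_smul, hx, smul_comm]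

/-- The numerical range of a unitary contains the hull of its spectrum. -/
theorem exists_unit_vector_of_mem_convexHull {U : Matrix ι ι ℂ}
    (hU : U ∈ Matrix.unitaryGroup ι ℂ) {z : ℂ} (hz : z ∈ convexHull ℝ (spectrum ℂ U)) :
    ∃ x : ι → ℂ, star x ⬝ᵥ x = 1 ∧ star x ⬝ᵥ (U *ᵥ x) = z := by
  classical
  have hU1 : Uᴴ * U = 1 := Matrix.mem_unitaryGroup_iff'.1 hU
  have hfin : (spectrum ℂ U).Finite := Matrix.finite_spectrum U
  rw [hfin.convexHull_eq] at hz
  obtain ⟨w, hw0, hw1, hwz⟩ := hz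
  rw [Finset.centerMass_eq_of_sum_1 _ _ hw1] at hwz
  choose! v hv hvU using fun a (ha : a ∈ spectrum ℂ U) => exists_unit_eigenvector ha
  have horth : ∀ a ∈ hfin.toFinset, ∀ b ∈ hfin.toFinset,
      star (v a) ⬝ᵥ v b = if a = b then 1 else 0 := by
    intro a ha b hb
    rw [hfin.mem_toFinset] at ha hb
    split_ifs with h
    · rw [← h, hv a ha]
    · exact dotProduct_eq_zero_of_eigenvalue_ne hU1 (hvU a ha) (hvU b hb)
        (norm_eq_one_of_mem_spectrum hU ha) h
  -- Orthonormal eigenvectors superposed with the square roots of the convex weights; the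
  -- expectation is then the convex combination.
  set x : ι → ℂ := ∑ a ∈ hfin.toFinset, (√(w a) : ℂ) • v a with hx
  have hUx : U *ᵥ x = ∑ a ∈ hfin.toFinset, ((√(w a) : ℂ) * a) • v a := by
    rw [hx, Matrix.mulVec_sum]
    refine Finset.sum_congr rfl fun a ha => ?_
    rw [Matrix.mulVec_smul, hvU a (hfin.mem_toFinset.1 ha), smul_smul]
  have hdot : ∀ c : ℂ → ℂ, star x ⬝ᵥ (∑ a ∈ hfin.toFinset, ((√(w a) : ℂ) * c a) • v a) =
      ∑ a ∈ hfin.toFinset, (w a : ℂ) * c a := by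
    intro c
    rw [hx, star_sum, sum_dotProduct]
    refine Finset.sum_congr rfl fun a ha => ?_
    rw [dotProduct_sum, Finset.sum_eq_single_of_mem a ha]
    · have hsq : (√(w a) : ℂ) * √(w a) = w a := by
        rw [← Complex.ofReal_mul, Real.mul_self_sqrt (hw0 a (hfin.mem_toFinset.1 ha))]
      rw [star_smul, smul_dotProduct, dotProduct_smul, horth a ha a ha, if_pos rfl, ← hsq]
      simp only [Complex.star_def, Complex.conj_ofReal, smul_eq_mul]
      ring
    · intro b hb hba
      rw [star_smul, smul_dotProduct, dotProduct_smul, horth a ha b hb, if_neg hba.symm,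
        smul_zero, smul_zero]
  refine ⟨x, ?_, ?_⟩
  · have h := hdot fun _ => 1
    simp only [mul_one] at h
    rw [hx] at h ⊢
    rw [h, ← Complex.ofReal_sum, hw1, Complex.ofReal_one]
  · rw [hUx, hdot fun a => a, ← hwz]
    simp [Complex.real_smul]

end Eigenvectors

/-! ### Overlaps of the parallel outputs. -/

section Parallel

variable {d N : ℕ} {U₀ U₁ : Matrix (Fin d) (Fin d) ℂ}

theorem useUnitary_isometry (hU₀ : U₀ᴴ * U₀ = 1) (hU₁ : U₁ᴴ * U₁ = 1) (n k : ℕ) :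
    (useUnitary U₀ U₁ n k)ᴴ * useUnitary U₀ U₁ n k = 1 := by
  unfold useUnitary
  split_ifs <;> assumption

theorem parallelUnitary_isometry (hU₀ : U₀ᴴ * U₀ = 1) (hU₁ : U₁ᴴ * U₁ = 1) (n : ℕ) :
    (parallelUnitary N U₀ U₁ n)ᴴ * parallelUnitary N U₀ U₁ n = 1 := by
  rw [parallelUnitary_eq, piTensor_conjTranspose, piTensor_mul]
  simp only [useUnitary_isometry hU₀ hU₁, piTensor_one]

/-- Rotating `U₁` by a phase changes each output by a phase only, so the eigenvalues may be rotated
without affecting probabilities. -/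
theorem parallelUnitary_smul (a : ℂ) (n : ℕ) :
    parallelUnitary N U₀ (a • U₁) n =
      (∏ k : Fin N, if n < (k : ℕ) + 1 then a else 1) • parallelUnitary N U₀ U₁ n := by
  ext i j
  simp only [parallelUnitary, Matrix.of_apply, Matrix.smul_apply, smul_eq_mul,
    ← Finset.prod_mul_distrib]
  refine Finset.prod_congr rfl fun k _ => ?_
  unfold useUnitary
  split_ifs <;> simp

theorem inputVector_eq (γ : ℝ) (v : Fin 2 → Fin d → ℂ) :
    inputVector N γ v = ∑ b : Fin N → Fin 2, (amplitude γ b : ℂ) • piVec fun k => v (b k) := by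
  ext i
  simp [inputVector, piVec, Finset.sum_apply]

/-- The overlaps of the output states: the input is an eigenvector superposition, so they are
expectations along the Markov chain. -/
theorem gram_parallelUnitary {M : ℕ} {γ ν r : ℝ} (hγ : 0 < γ) (hr : 0 < r)
    (hr2 : (1 + γ) * r ^ 2 = 1 - γ) (hν : ν = (1 + γ) * r) {s : Fin 2 → ℝ} (hs : s 0 ^ 2 = 1)
    (hs1 : s 1 = -s 0) {v : Fin 2 → Fin d → ℂ} {l : Fin 2 → ℂ}
    (hl : ∀ c, l c = (ν : ℂ) + ((γ * s c : ℝ) : ℂ) * Complex.I)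
    (hU₀ : U₀ᴴ * U₀ = 1) (hU₁ : U₁ᴴ * U₁ = 1) (hv : ∀ c, (U₀ᴴ * U₁) *ᵥ v c = l c • v c)
    (hvo : ∀ c c', star (v c) ⬝ᵥ v c' = if c = c' then 1 else 0) {n L : ℕ}
    (hL : n + L ≤ M + 1) :
    star (parallelUnitary (M + 1) U₀ U₁ n *ᵥ inputVector (M + 1) γ v) ⬝ᵥ
      (parallelUnitary (M + 1) U₀ U₁ (n + L) *ᵥ inputVector (M + 1) γ v) =
      (((1 + γ * L) * r ^ L : ℝ) : ℂ) := by
  set μ : Fin 2 → ℂ := fun c => star (l c) with hμ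
  have hμ' : ∀ c, μ c = (ν : ℂ) - ((γ * s c : ℝ) : ℂ) * Complex.I := fun c => by
    simp only [hμ, hl]
    apply Complex.ext <;> simp
  -- The two hypotheses disagree only inside the block, where `U₁` meets `U₀` and the overlap is a
  -- conjugate eigenvalue.
  have hfac : ∀ k c c', star (useUnitary U₀ U₁ n k *ᵥ v c) ⬝ᵥ
      (useUnitary U₀ U₁ (n + L) k *ᵥ v c') = if c = c' then blockFactor μ n L k c else 0 := by
    intro k c c'
    have hsame : ∀ A : Matrix (Fin d) (Fin d) ℂ, Aᴴ * A = 1 →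
        star (A *ᵥ v c) ⬝ᵥ (A *ᵥ v c') = if c = c' then 1 else 0 := fun A hA => by
      rw [star_mulVec_dotProduct_self hA, hvo]
    unfold useUnitary blockFactor
    by_cases h1 : n < k + 1
    · by_cases h2 : n + L < k + 1
      · have h3 : ¬(n ≤ k ∧ k < n + L) := by omega
        rw [if_pos h1, if_pos h2, if_neg h3, hsame _ hU₁]
      · have h3 : n ≤ k ∧ k < n + L := by omega
        rw [if_pos h1, if_neg h2, if_pos h3, star_mulVec_dotProduct, hv, star_smul,
          smul_dotProduct, hvo, hμ]
        simp
    · have h2 : ¬n + L < k + 1 := by omega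
      have h3 : ¬(n ≤ k ∧ k < n + L) := by omega
      rw [if_neg h1, if_neg h2, if_neg h3, hsame _ hU₀]
  have hout : ∀ n, parallelUnitary (M + 1) U₀ U₁ n *ᵥ inputVector (M + 1) γ v =
      ∑ b : Fin (M + 1) → Fin 2, (amplitude γ b : ℂ) •
        piVec fun k => useUnitary U₀ U₁ n k *ᵥ v (b k) := fun n => by
    rw [inputVector_eq, Matrix.mulVec_sum]
    refine Finset.sum_congr rfl fun b _ => ?_
    rw [Matrix.mulVec_smul, parallelUnitary_eq, piTensor_mulVec]
  rw [hout, hout, star_sum, sum_dotProduct,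
    ← sum_chainValue_block hγ hr hr2 hν hs hs1 hμ' n L M hL, ← sum_chain]
  refine Finset.sum_congr rfl fun b _ => ?_
  have hprod : ∀ b' : Fin (M + 1) → Fin 2,
      star (piVec fun k => useUnitary U₀ U₁ n k *ᵥ v (b k)) ⬝ᵥ
        (piVec fun k : Fin (M + 1) => useUnitary U₀ U₁ (n + L) k *ᵥ v (b' k)) =
      if b = b' then ∏ k : Fin (M + 1), blockFactor μ n L k (b k) else 0 := fun b' => by
    rw [star_piVec_dotProduct]
    simp only [hfac, Finset.prod_ite_zero, funext_iff, Finset.mem_univ, true_implies]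
  rw [dotProduct_sum, Finset.sum_eq_single_of_mem b (Finset.mem_univ b)]
  · rw [star_smul, smul_dotProduct, dotProduct_smul, hprod, if_pos rfl, smul_smul, smul_eq_mul,
      ← mul_assoc]
    congr 1
    have h := congrArg (fun x : ℝ => (x : ℂ)) (amplitude_sq hγ b)
    push_cast at h
    rw [Complex.star_def, Complex.conj_ofReal, ← sq, h]
  · intro b' _ hb
    rw [star_smul, smul_dotProduct, dotProduct_smul, hprod, if_neg hb.symm, smul_zero, smul_zero]

end Parallel

/-! ### Optimal protocols and the exceptional cases. -/

section Optimal

variable {d N : ℕ} {U₀ U₁ : Matrix (Fin d) (Fin d) ℂ}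

theorem sum_rowWeight (hN : 1 ≤ N) (γ : ℝ) :
    ∑ n : Fin (N + 1), rowWeight N γ n = N * γ + 1 := by
  obtain ⟨M, rfl⟩ : ∃ M, N = M + 1 := ⟨N - 1, by omega⟩
  rw [Fin.sum_univ_succ, Fin.sum_univ_castSucc]
  have h : ∀ k : Fin M, rowWeight (M + 1) γ k.castSucc.succ = γ := fun k => by
    unfold rowWeight
    rw [if_neg]
    simp only [Fin.val_succ, Fin.val_castSucc]
    omega
  simp only [h]
  simp [rowWeight]
  ring

/-- The optimal ancilla-free strategy and its outcome statistics. -/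
theorem exists_optimal_protocol (hN : 1 ≤ N) {γ ν : ℝ} (hγ : 0 < γ) (hν : 0 < ν)
    (hγν : γ ^ 2 + ν ^ 2 = 1) (hU₀ : U₀ ∈ Matrix.unitaryGroup (Fin d) ℂ)
    (hU₁ : U₁ ∈ Matrix.unitaryGroup (Fin d) ℂ) {e : ℂ} (he : star e * e = 1) {s : ℝ}
    (hs : s ^ 2 = 1) {l₀ l₁ : ℂ} (hn₀ : ‖l₀‖ = 1)
    (hl₀ : star e * l₀ = ν + (γ * s : ℝ) * Complex.I)
    (hl₁ : star e * l₁ = ν - (γ * s : ℝ) * Complex.I) {v : Fin 2 → Fin d → ℂ}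
    (hv : ∀ c, star (v c) ⬝ᵥ v c = 1) (hv₀ : (U₀ᴴ * U₁) *ᵥ v 0 = l₀ • v 0)
    (hv₁ : (U₀ᴴ * U₁) *ᵥ v 1 = l₁ • v 1) :
    ∃ (p : Fin (N + 1) → (Fin N → Fin d) → ℂ) (S : Protocol (Fin N → Fin d) N),
      (∀ m m', star (p m) ⬝ᵥ p m' = if m = m' then 1 else 0) ∧
      S.ρ = pureState (inputVector N γ v) ∧
      (∀ m, m ≠ Fin.last N → S.Q m = pureState (p m)) ∧
      (∀ m n : Fin (N + 1),
        ‖star (p m) ⬝ᵥ (parallelUnitary N U₀ U₁ n).mulVec (inputVector N γ v)‖ ^ 2 =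
          truncatedLaplace ((1 - γ) / (1 + γ)) m n ∧
        S.prob (parallelUnitary N U₀ U₁) m n = truncatedLaplace ((1 - γ) / (1 + γ)) m n) ∧
      S.success (parallelUnitary N U₀ U₁) = (N * γ + 1) / (N + 1) := by
  have hγ1 : γ < 1 := by nlinarith
  have hζ0 := zeta_pos hγ hγ1
  have hζ1 : (1 - γ) / (1 + γ) < 1 := zeta_lt_one hγ
  set ζ := (1 - γ) / (1 + γ) with hζ
  set r : ℝ := √ζ with hr
  have hr0 : 0 < r := Real.sqrt_pos.2 hζ0
  have hrζ : r ^ 2 = ζ := Real.sq_sqrt hζ0.le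
  have hr2 : (1 + γ) * r ^ 2 = 1 - γ := by
    rw [hrζ, hζ]
    field_simp
  -- Both squares equal `1 - γ² = (1 + γ)(1 - γ)`.
  have hνr : ν = (1 + γ) * r := by
    refine (pow_left_inj₀ hν.le (by positivity) two_ne_zero).1 ?_
    linear_combination hγν - (1 + γ) * hr2
  have hI₀ : U₀ᴴ * U₀ = 1 := Matrix.mem_unitaryGroup_iff'.1 hU₀
  have hI₁ : U₁ᴴ * U₁ = 1 := Matrix.mem_unitaryGroup_iff'.1 hU₁
  have hII : (U₀ᴴ * U₁)ᴴ * (U₀ᴴ * U₁) = 1 := by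
    rw [Matrix.conjTranspose_mul, Matrix.conjTranspose_conjTranspose, Matrix.mul_assoc,
      ← Matrix.mul_assoc U₀, show U₀ * U₀ᴴ = 1 from Matrix.mem_unitaryGroup_iff.1 hU₀,
      Matrix.one_mul, hI₁]
  have hI₁' : (star e • U₁)ᴴ * (star e • U₁) = 1 := by
    rw [Matrix.conjTranspose_smul, star_star, Matrix.smul_mul, Matrix.mul_smul, smul_smul, hI₁,
      mul_comm e, he, one_smul]
  have hll : l₀ ≠ l₁ := fun h => by
    rw [h, hl₁] at hl₀
    have h1 := congrArg Complex.im hl₀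
    simp only [Complex.sub_im, Complex.add_im, Complex.mul_im, Complex.ofReal_re,
      Complex.ofReal_im, Complex.I_im, Complex.I_re, mul_one, mul_zero, add_zero,
      zero_add] at h1
    have h2 : γ * s = 0 := by linarith
    rcases mul_eq_zero.1 h2 with h | h
    · exact hγ.ne' h
    · simp [h] at hs
  have hv01 := dotProduct_eq_zero_of_eigenvalue_ne hII hv₀ hv₁ hn₀ hll
  have hvo : ∀ c c', star (v c) ⬝ᵥ v c' = if c = c' then 1 else 0 := by
    have hv10 : star (v 1) ⬝ᵥ v 0 = 0 := by
      rw [Matrix.star_dotProduct, hv01, star_zero]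
    intro c c'
    fin_cases c <;> fin_cases c' <;> simp [hv, hv01, hv10]
  have hgram : ∀ n L, n + L ≤ N →
      star (parallelUnitary N U₀ (star e • U₁) n *ᵥ inputVector N γ v) ⬝ᵥ
        (parallelUnitary N U₀ (star e • U₁) (n + L) *ᵥ inputVector N γ v) =
      (((1 + γ * L) * r ^ L : ℝ) : ℂ) := by
    obtain ⟨M, rfl⟩ : ∃ M, N = M + 1 := ⟨N - 1, by omega⟩
    intro n L hnL
    refine gram_parallelUnitary (s := ![s, -s]) (l := ![star e * l₀, star e * l₁]) hγ hr0 hr2 hνr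
      (by simpa using hs) (by simp) (fun c => ?_) hI₀ hI₁' (fun c => ?_) hvo hnL
    · fin_cases c
      · simpa using hl₀
      · simp only [Fin.mk_one, Matrix.cons_val_one, Matrix.cons_val_zero]
        rw [hl₁]
        push_cast
        ring
    · rw [Matrix.mul_smul, Matrix.smul_mulVec]
      fin_cases c
      · simpa [smul_smul] using congrArg (fun x => star e • x) hv₀
      · simpa [smul_smul] using congrArg (fun x => star e • x) hv₁
  set ψ := inputVector N γ v with hψ
  -- The entries are the square roots of the desired probabilities; `A†A` turns out to be the Gram
  -- matrix of the rotated outputs.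
  set A : Matrix (Fin (N + 1)) (Fin (N + 1)) ℂ :=
    Matrix.diagonal (fun m : Fin (N + 1) => ((√(rowWeight N γ m) : ℝ) : ℂ)) *
      Matrix.of (fun m n : Fin (N + 1) => (r : ℂ) ^ ((m : ℤ) - n).natAbs) with hA
  have hAapp : ∀ m n, A m n = ((√(rowWeight N γ m) * r ^ ((m : ℤ) - n).natAbs : ℝ) : ℂ) := by
    intro m n
    rw [hA, Matrix.diagonal_mul, Matrix.of_apply]
    push_cast
    rfl
  have hAdet : IsUnit A.det := by
    rw [hA, Matrix.det_mul, Matrix.det_diagonal]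
    refine IsUnit.mul (isUnit_iff_ne_zero.2 (Finset.prod_ne_zero_iff.2 fun m _ => ?_))
      (isUnit_det_pow_natAbs ?_)
    · exact_mod_cast (Real.sqrt_pos.2 (rowWeight_pos hγ m)).ne'
    · rw [← Complex.ofReal_pow, hrζ]
      exact_mod_cast hζ1.ne
  have hsumA : ∀ n L, n + L ≤ N → ∑ m : Fin (N + 1), rowWeight N γ m *
      (r ^ ((m : ℤ) - n).natAbs * r ^ ((m : ℤ) - (n + L : ℕ)).natAbs) =
      (1 + γ * L) * r ^ L := fun n L hnL => by
    rw [← sum_rowWeight_mul_pow hγ hrζ hN hnL, Finset.sum_range]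
  have hAA : ∀ n n' : Fin (N + 1), (Aᴴ * A) n n' = ((∑ m : Fin (N + 1), rowWeight N γ m *
      (r ^ ((m : ℤ) - n).natAbs * r ^ ((m : ℤ) - n').natAbs) : ℝ) : ℂ) := by
    intro n n'
    rw [Matrix.mul_apply, Complex.ofReal_sum]
    refine Finset.sum_congr rfl fun m _ => ?_
    rw [Matrix.conjTranspose_apply, hAapp, hAapp, Complex.star_def, Complex.conj_ofReal,
      ← Complex.ofReal_mul]
    congr 1
    have := Real.mul_self_sqrt (rowWeight_pos (N := N) hγ m).le
    linear_combination (r ^ ((m : ℤ) - n).natAbs * r ^ ((m : ℤ) - n').natAbs) * this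
  set φ : Fin (N + 1) → (Fin N → Fin d) → ℂ :=
    fun n => parallelUnitary N U₀ (star e • U₁) n *ᵥ ψ with hφ
  have hle : ∀ n n' : Fin (N + 1), n ≤ n' → star (φ n) ⬝ᵥ φ n' = (Aᴴ * A) n n' := by
    intro n n' h
    obtain ⟨L, hL⟩ := Nat.exists_eq_add_of_le (Fin.le_def.1 h)
    have h1 := hgram n L (by omega)
    rw [← hL, ← hsumA n L (by omega), ← hL] at h1
    rw [hAA, ← h1]
  have hG : ∀ n n' : Fin (N + 1), star (φ n) ⬝ᵥ φ n' = (Aᴴ * A) n n' := by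
    intro n n'
    rcases le_total n n' with h | h
    · exact hle n n' h
    · have h1 := congrArg star (hle n' n h)
      rw [← Matrix.conjTranspose_apply, Matrix.conjTranspose_mul,
        Matrix.conjTranspose_conjTranspose] at h1
      rw [← h1, ← Matrix.star_dotProduct]
  obtain ⟨p, hp, hpA⟩ := exists_orthonormal_of_gram hAdet hG
  have hprob : ∀ m n : Fin (N + 1), ‖star (p m) ⬝ᵥ parallelUnitary N U₀ U₁ n *ᵥ ψ‖ ^ 2 =
      rowWeight N γ m * (r ^ ((m : ℤ) - n).natAbs * r ^ ((m : ℤ) - n).natAbs) := by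
    intro m n
    have h1 : ‖star (p m) ⬝ᵥ φ n‖ = ‖star (p m) ⬝ᵥ parallelUnitary N U₀ U₁ n *ᵥ ψ‖ := by
      have hen : ‖star e‖ = 1 := by
        have h2 := congrArg norm he
        rw [norm_mul, norm_star, norm_one] at h2
        rw [norm_star]
        nlinarith [norm_nonneg e]
      rw [hφ]
      dsimp only
      rw [parallelUnitary_smul, Matrix.smul_mulVec, dotProduct_smul, smul_eq_mul, norm_mul,
        norm_prod, Finset.prod_eq_one, one_mul]
      intro k _
      split_ifs
      · exact hen
      · exact norm_one
    rw [← h1, hpA, hAapp, Complex.norm_real, Real.norm_eq_abs, sq_abs, mul_pow,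
      Real.sq_sqrt (rowWeight_pos hγ m).le]
    ring
  have hTL : ∀ m n : Fin (N + 1), ‖star (p m) ⬝ᵥ parallelUnitary N U₀ U₁ n *ᵥ ψ‖ ^ 2 =
      truncatedLaplace ζ m n := fun m n => by
    rw [hprob, truncatedLaplace_eq hγ hγ1, ← hζ, ← mul_pow, ← sq, hrζ]
  have hψ1 : star ψ ⬝ᵥ ψ = 1 := by
    rw [← star_mulVec_dotProduct_self (parallelUnitary_isometry hI₀ hI₁' 0)]
    simpa using hgram 0 0 (by omega)
  obtain ⟨S, hS, hSQ, hSp⟩ := exists_protocol hp hψ1 (parallelUnitary_isometry hI₀ hI₁)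
    fun n => by
      simp only [hprob]
      simpa using hsumA n 0 (by omega)
  refine ⟨p, S, hp, hS, hSQ, fun m n => ⟨hTL m n, (hSp m n).trans (hTL m n)⟩, ?_⟩
  rw [Protocol.success, ← sum_rowWeight hN γ, one_div, inv_mul_eq_div]
  congr 1
  refine Finset.sum_congr rfl fun n _ => ?_
  rw [hSp, hprob]
  simp

/-- If the hull of the eigenvalues contains the origin, then the change point can be identified
with certainty. -/
theorem one_mem_ancillaFreeValues (hU₀ : U₀ ∈ Matrix.unitaryGroup (Fin d) ℂ)
    (hU₁ : U₁ ∈ Matrix.unitaryGroup (Fin d) ℂ) (h0 : (0 : ℂ) ∈ eigenPolygon U₀ U₁) :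
    1 ∈ ancillaFreeValues N U₀ U₁ := by
  have hI₀ : U₀ᴴ * U₀ = 1 := Matrix.mem_unitaryGroup_iff'.1 hU₀
  have hI₁ : U₁ᴴ * U₁ = 1 := Matrix.mem_unitaryGroup_iff'.1 hU₁
  obtain ⟨x, hx, hxU⟩ := exists_unit_vector_of_mem_convexHull
    (mul_mem (Unitary.star_mem hU₀) hU₁ : U₀ᴴ * U₁ ∈ Matrix.unitaryGroup (Fin d) ℂ) h0
  have h01 : star (U₀ *ᵥ x) ⬝ᵥ (U₁ *ᵥ x) = 0 := by
    rw [Matrix.star_mulVec, ← Matrix.dotProduct_mulVec, Matrix.mulVec_mulVec, hxU]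
  have h10 : star (U₁ *ᵥ x) ⬝ᵥ (U₀ *ᵥ x) = 0 := by
    rw [Matrix.star_dotProduct, h01, star_zero]
  set ψ : (Fin N → Fin d) → ℂ := piVec fun _ => x with hψ
  have hout : ∀ n, parallelUnitary N U₀ U₁ n *ᵥ ψ = piVec fun k => useUnitary U₀ U₁ n k *ᵥ x :=
    fun n => by rw [parallelUnitary_eq, hψ, piTensor_mulVec]
  have hψ1 : star ψ ⬝ᵥ ψ = 1 := by
    rw [hψ, star_piVec_dotProduct]
    simp [hx]
  -- The outputs themselves are orthonormal: at the use with index `min m m'` the factors are `U₁ x`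
  -- and `U₀ x`.
  have hp : ∀ m m' : Fin (N + 1), star (parallelUnitary N U₀ U₁ m *ᵥ ψ) ⬝ᵥ
      (parallelUnitary N U₀ U₁ m' *ᵥ ψ) = if m = m' then 1 else 0 := by
    intro m m'
    split_ifs with h
    · rw [h, star_mulVec_dotProduct_self (parallelUnitary_isometry hI₀ hI₁ _), hψ1]
    · rw [hout, hout, star_piVec_dotProduct, Finset.prod_eq_zero_iff]
      have hne : (m : ℕ) ≠ m' := fun h' => h (Fin.ext h')
      rcases lt_or_gt_of_ne hne with hlt | hlt
      · refine ⟨⟨m, by omega⟩, Finset.mem_univ _, ?_⟩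
        simp only [useUnitary]
        rw [if_pos (by omega), if_neg (by omega), h10]
      · refine ⟨⟨m', by omega⟩, Finset.mem_univ _, ?_⟩
        simp only [useUnitary]
        rw [if_neg (by omega), if_pos (by omega), h01]
  obtain ⟨S, -, -, hS⟩ := exists_protocol hp hψ1 (parallelUnitary_isometry hI₀ hI₁)
    fun n => by simp [hp, apply_ite]
  refine ⟨S, ?_⟩
  have hN : (N : ℝ) + 1 ≠ 0 := by positivity
  simp only [Protocol.success, hS, hp, if_true]
  simp [hN]

/-- The success probability of guessing. -/
theorem guess_mem_ancillaFreeValues {x : Fin d → ℂ} (hx : star x ⬝ᵥ x = 1)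
    (hI₀ : U₀ᴴ * U₀ = 1) (hI₁ : U₁ᴴ * U₁ = 1) : 1 / ((N : ℝ) + 1) ∈ ancillaFreeValues N U₀ U₁ := by
  have hψ1 : star (piVec fun _ : Fin N => x) ⬝ᵥ (piVec fun _ : Fin N => x) = 1 := by
    rw [star_piVec_dotProduct]
    simp [hx]
  refine ⟨⟨_, isState_pureState hψ1, Pi.single 0 1, fun m => ?_, ?_⟩, ?_⟩
  · by_cases h : m = 0
    · rw [h, Pi.single_eq_same]
      exact Matrix.PosSemidef.one
    · rw [Pi.single_eq_of_ne h]
      exact Matrix.PosSemidef.zero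
  · rw [Finset.sum_pi_single']
    simp
  · rw [Protocol.success, Finset.sum_eq_single_of_mem 0 (Finset.mem_univ _)]
    · simp only [Protocol.prob, Pi.single_eq_same, Matrix.one_mul]
      rw [trace_conjBy (parallelUnitary_isometry hI₀ hI₁ _), (isState_pureState hψ1).2]
      simp
    · intro n _ hn
      simp [Protocol.prob, Pi.single_eq_of_ne hn]

/-- Any two states satisfy the domination condition with `γ = 1`, with the first state as dominating
operator, so the same telescoping applies. -/
theorem Strategy.success_le_one (S : Strategy d N) (hI₀ : U₀ᴴ * U₀ = 1) (hI₁ : U₁ᴴ * U₁ = 1) :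
    S.success U₀ U₁ ≤ 1 := by
  have hstate : ∀ n : ℕ, IsState (S.output (useUnitary U₀ U₁ n) (N - 1)) := fun n =>
    S.output_isState (useUnitary_isometry hI₀ hI₁ n) le_rfl
  have h := sum_trace_mul_le S.isMeasurement (γ := 1)
    (fun n => S.output (useUnitary U₀ U₁ n) (N - 1)) (hstate N).2
    fun n _ => ⟨_, (hstate n).1, by simpa using (hstate (n + 1)).1, by simp [(hstate n).2]⟩
  rw [Strategy.success, one_div, inv_mul_eq_div, div_le_one (by positivity)]
  rw [mul_one] at h
  exact h

end Optimal

end ChangePoint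

theorem theorem1 (d N : ℕ) (hN : 1 ≤ N) (U₀ U₁ : Matrix (Fin d) (Fin d) ℂ)
    (hU₀ : U₀ ∈ Matrix.unitaryGroup (Fin d) ℂ) (hU₁ : U₁ ∈ Matrix.unitaryGroup (Fin d) ℂ)
    (l₀ l₁ : ℂ)
    (hside : ChangePoint.IsClosestSide (spectrum ℂ (U₀.conjTranspose * U₁)) l₀ l₁)
    (γ : ℝ) (hγ : γ = ChangePoint.gammaParam U₀ U₁ l₀ l₁) :
    -- the value of the maximum success probabilities
    (ChangePoint.maxSuccess N U₀ U₁ = (N * γ + 1) / (N + 1) ∧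
      ChangePoint.maxSuccessNonadaptive N U₀ U₁ = (N * γ + 1) / (N + 1)) ∧
    -- the maxima are attained, also without ancillary system
    (IsGreatest (ChangePoint.generalValues N U₀ U₁) ((N * γ + 1) / (N + 1)) ∧
      IsGreatest (ChangePoint.nonadaptiveValues N U₀ U₁) ((N * γ + 1) / (N + 1)) ∧
      IsGreatest (ChangePoint.ancillaFreeValues N U₀ U₁) ((N * γ + 1) / (N + 1))) ∧
    -- the maximum is below one exactly if the polygon does not contain the origin
    (ChangePoint.maxSuccess N U₀ U₁ < 1 ↔ (0 : ℂ) ∉ ChangePoint.eigenPolygon U₀ U₁) ∧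
    -- an optimal input and the outcome statistics
    (∀ v : Fin 2 → Fin d → ℂ,
      (∀ c, star (v c) ⬝ᵥ v c = 1) →
      (U₀.conjTranspose * U₁).mulVec (v 0) = l₀ • v 0 →
      (U₀.conjTranspose * U₁).mulVec (v 1) = l₁ • v 1 →
      0 < γ → ChangePoint.maxSuccess N U₀ U₁ < 1 →
      ∃ (p : Fin (N + 1) → (Fin N → Fin d) → ℂ) (S : ChangePoint.Protocol (Fin N → Fin d) N),
        (∀ m m', star (p m) ⬝ᵥ p m' = if m = m' then 1 else 0) ∧
        S.ρ = ChangePoint.pureState (ChangePoint.inputVector N γ v) ∧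
        (∀ m, m ≠ Fin.last N → S.Q m = ChangePoint.pureState (p m)) ∧
        (∀ m n : Fin (N + 1),
          ‖star (p m) ⬝ᵥ (ChangePoint.parallelUnitary N U₀ U₁ n).mulVec
              (ChangePoint.inputVector N γ v)‖ ^ 2 =
            ChangePoint.truncatedLaplace ((1 - γ) / (1 + γ)) m n ∧
          S.prob (ChangePoint.parallelUnitary N U₀ U₁) m n =
            ChangePoint.truncatedLaplace ((1 - γ) / (1 + γ)) m n) ∧
        S.success (ChangePoint.parallelUnitary N U₀ U₁) = (N * γ + 1) / (N + 1)) := by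
  have hI₀ : U₀.conjTranspose * U₀ = 1 := Matrix.mem_unitaryGroup_iff'.1 hU₀
  have hI₁ : U₁.conjTranspose * U₁ = 1 := Matrix.mem_unitaryGroup_iff'.1 hU₁
  have hU : U₀.conjTranspose * U₁ ∈ Matrix.unitaryGroup (Fin d) ℂ := mul_mem (Unitary.star_mem hU₀) hU₁
  have hNpos : (0 : ℝ) < N := by exact_mod_cast hN
  have hspec : ∀ z ∈ spectrum ℂ (U₀.conjTranspose * U₁), ‖z‖ = 1 := fun z hz =>
    ChangePoint.norm_eq_one_of_mem_spectrum hU hz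
  have hrot : (0 : ℂ) ∉ ChangePoint.eigenPolygon U₀ U₁ → _ := fun h0 =>
    hside.exists_rotation (Matrix.finite_spectrum _) hspec h0
  have hγ' : (0 : ℂ) ∉ ChangePoint.eigenPolygon U₀ U₁ → γ = ‖l₁ - l₀‖ / 2 := fun h0 => by
    rw [hγ, ChangePoint.gammaParam, if_neg h0]
  have hupper : ∀ p ∈ ChangePoint.generalValues N U₀ U₁, p ≤ (N * γ + 1) / (N + 1) := by
    rintro _ ⟨S, rfl⟩
    by_cases h0 : (0 : ℂ) ∈ ChangePoint.eigenPolygon U₀ U₁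
    · rw [hγ, ChangePoint.gammaParam, if_pos h0, mul_one, div_self (by positivity)]
      exact S.success_le_one hI₀ hI₁
    · obtain ⟨e, ν, he, hν, hγν, hle, -⟩ := hrot h0
      rw [← hγ' h0] at hγν
      refine S.success_le (by rw [hγ' h0]; positivity) hν.le hγν hI₀ hI₁ he ?_
      have := ChangePoint.posSemidef_of_forall_mem_spectrum hU hle
      simpa only [Matrix.mul_smul, Matrix.conjTranspose_smul, star_star, Matrix.smul_mul,
        Matrix.conjTranspose_mul, Matrix.conjTranspose_conjTranspose] using this
  have hdata : (0 : ℂ) ∉ ChangePoint.eigenPolygon U₀ U₁ → ∃ (e : ℂ) (ν s : ℝ),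
      star e * e = 1 ∧ 0 < ν ∧ γ ^ 2 + ν ^ 2 = 1 ∧ s ^ 2 = 1 ∧
      star e * l₀ = ν + (γ * s : ℝ) * Complex.I ∧
      star e * l₁ = ν - (γ * s : ℝ) * Complex.I := fun h0 => by
    obtain ⟨e, ν, he, hν, hγν, -, s, hs, hl₀, hl₁⟩ := hrot h0
    rw [← hγ' h0] at hγν hl₀ hl₁
    exact ⟨e, ν, s, he, hν, hγν, hs, hl₀, hl₁⟩
  have hattained : (N * γ + 1) / (N + 1) ∈ ChangePoint.ancillaFreeValues N U₀ U₁ := by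
    by_cases h0 : (0 : ℂ) ∈ ChangePoint.eigenPolygon U₀ U₁
    · rw [hγ, ChangePoint.gammaParam, if_pos h0, mul_one, div_self (by positivity)]
      exact ChangePoint.one_mem_ancillaFreeValues hU₀ hU₁ h0
    · obtain ⟨x₀, hx₀, hxU₀⟩ := ChangePoint.exists_unit_eigenvector hside.1.1
      obtain ⟨x₁, hx₁, hxU₁⟩ := ChangePoint.exists_unit_eigenvector hside.1.2.1
      have hγ0 : 0 ≤ γ := by rw [hγ' h0]; positivity
      -- For `γ = 0` the bound is `1 / (N + 1)`, reached by constant guessing; otherwise the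
      -- Markov-chain input applies.
      rcases hγ0.eq_or_lt with h | h
      · rw [← h, mul_zero, zero_add]
        exact ChangePoint.guess_mem_ancillaFreeValues hx₀ hI₀ hI₁
      · obtain ⟨e, ν, s, he, hν, hγν, hs, hl₀, hl₁⟩ := hdata h0
        obtain ⟨_, S, -, -, -, -, hS⟩ := ChangePoint.exists_optimal_protocol hN h hν hγν hU₀ hU₁
          he hs (hspec _ hside.1.1) hl₀ hl₁ (v := ![x₀, x₁])
          (fun c => by fin_cases c <;> simpa) hxU₀ hxU₁
        exact ⟨S, hS⟩
  have hsub := ChangePoint.ancillaFreeValues_subset (N := N) U₀ U₁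
  have hsub' := ChangePoint.nonadaptiveValues_subset hN U₀ U₁
  have hgen : IsGreatest (ChangePoint.generalValues N U₀ U₁) ((N * γ + 1) / (N + 1)) :=
    ⟨hsub' (hsub hattained), hupper⟩
  have hnon : IsGreatest (ChangePoint.nonadaptiveValues N U₀ U₁) ((N * γ + 1) / (N + 1)) :=
    ⟨hsub hattained, fun p hp => hupper p (hsub' hp)⟩
  have hfree : IsGreatest (ChangePoint.ancillaFreeValues N U₀ U₁) ((N * γ + 1) / (N + 1)) :=
    ⟨hattained, fun p hp => hupper p (hsub' (hsub hp))⟩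
  have hlt : ChangePoint.maxSuccess N U₀ U₁ < 1 ↔ (0 : ℂ) ∉ ChangePoint.eigenPolygon U₀ U₁ := by
    rw [ChangePoint.maxSuccess, hgen.csSup_eq, div_lt_one (by positivity)]
    constructor
    · intro h h0
      rw [hγ, ChangePoint.gammaParam, if_pos h0, mul_one] at h
      exact lt_irrefl _ h
    · intro h0
      obtain ⟨e, ν, -, hν, hγν, -⟩ := hrot h0
      rw [← hγ' h0] at hγν
      -- The origin is at distance `ν > 0` from the polygon, so `γ² = 1 - ν² < 1`.
      have : γ < 1 := by nlinarith
      nlinarith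
  refine ⟨⟨hgen.csSup_eq, hnon.csSup_eq⟩, ⟨hgen, hnon, hfree⟩, hlt, ?_⟩
  intro v hv hv₀ hv₁ hpos hmax
  obtain ⟨e, ν, s, he, hν, hγν, hs, hl₀, hl₁⟩ := hdata (hlt.1 hmax)
  exact ChangePoint.exists_optimal_protocol hN hpos hν hγν hU₀ hU₁ he hs
    (hspec _ hside.1.1) hl₀ hl₁ hv hv₀ hv₁
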